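/- For a real number $r>1$ let $\sigma_{-r}(n)=\sum_{d\mid n}d^{-r}$ for $n\in\mathbb N=\{1,2,3,\dots\}$, and let $C_r$ be the number of connected components of the topological closure $\overline{\sigma_{-r}(\mathbb N)}\subseteq\mathbb R$. Let $p_1<p_2<\cdots$ be the prime numbers in increasing order. Call $p_m$ $r$-mighty if $$1+\frac1{p_m^r}>\prod_{t=m+1}^{\infty}\frac1{1-p_t^{-r}},$$ and let $L_r$ be the largest index $m$ such that $p_m$ is $r$-mighty, with $L_r=0$ if there is no $r$-mighty prime (and $L_r=\infty$ by convention if there were infinitely many). Then for every real $r>1$: 1. if $L_r\le 3$, then $C_r\le 5$; 2. if $L_r\ge 4$, then $C_r\ge 7$. Consequently $6$ is a Zubrilina number: there is no real $r>1$ for which $\overline{\sigma_{-r}(\mathbb N)}$ has exactly $6$ connected components. -/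

import Mathlib

noncomputable section

namespace Zubrilina

/-- The divisor function `σ_{-r}(n) = ∑_{d ∣ n} d^{-r}` for a real parameter `r`. -/
def sigmaNeg (r : ℝ) (n : ℕ) : ℝ :=
  ∑ d ∈ n.divisors, (d : ℝ) ^ (-r)

/-- The topological closure in `ℝ` of `σ_{-r}({1, 2, 3, …})`. -/
def sigmaClosure (r : ℝ) : Set ℝ :=
  closure (sigmaNeg r '' {n : ℕ | 0 < n})

/-- `C_r`: the number of connected components of the closure of `σ_{-r}({1, 2, 3, …})`
(with value `⊤` if there are infinitely many). -/
def numComponents (r : ℝ) : ℕ∞ :=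
  ENat.card (ConnectedComponents (sigmaClosure r))

/-- The prime `p` is `r`-mighty: `1 + p^{-r} > ∏_{q > p, q prime} 1 / (1 - q^{-r})`. -/
def IsMighty (r : ℝ) (p : ℕ) : Prop :=
  p.Prime ∧
    1 + (p : ℝ) ^ (-r) > ∏' q : {q : ℕ // q.Prime ∧ p < q}, 1 / (1 - (q : ℝ) ^ (-r))

/-- The `m`-th prime `p_m`, numbered from `p_1 = 2`. -/
def nthPrime (m : ℕ) : ℕ :=
  Nat.nth Nat.Prime (m - 1)

/-- `L_r`: the largest index `m ≥ 1` such that `p_m` is `r`-mighty, and `0` if there are no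
`r`-mighty primes (a supremum in `ℕ∞`, so it would be `⊤` if there were infinitely many). -/
def mightyIndex (r : ℝ) : ℕ∞ :=
  ⨆ m ∈ {m : ℕ | 1 ≤ m ∧ IsMighty r (nthPrime m)}, (m : ℕ∞)

/-- A positive integer `k` is a Zubrilina number if `C_r ≠ k` for every real `r > 1`. -/
def IsZubrilinaNumber (k : ℕ) : Prop :=
  0 < k ∧ ∀ r : ℝ, 1 < r → numComponents r ≠ (k : ℕ∞)

end Zubrilina

end

namespace Zubrilina

open Filter Topology

/-! Write P_k for the Euler product over the primes exceeding k (`eulerTail`). Integers with all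
prime factors above p have value in [1, P_p], and any other integer has value at least 1 + p^{-r},
so a mighty p opens the gap (P_p, 1 + p^{-r}) in the closure. Conversely, if no prime above k is
mighty, choosing exponents greedily, prime by prime, approximates every point of [1, P_k]
(`Icc_subset_roughClosure`).

Everything hinges on the prime 7. It is mighty for r ≥ 5/2 (`isMighty_seven`), and no larger prime
is mighty for r ≤ 3 (`not_isMighty_of_gt_seven`), so L_r ≥ 4 exactly when 7 is mighty.

If L_r ≤ 3, then r < 5/2 and [1, P_5] is filled. Multiplying by the values at powers of 5, 3 and 2
shows that the closure is a union of five intervals, possibly overlapping (`numComponents_le_five`).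
If 7 is mighty, then so are 5, 3 and 2, and the gaps at 7 and 5 recur after multiplication by 1 +
2^{-r}. These six gaps separate seven points (`seven_le_numComponents`). The count 6 is skipped
because a mighty 7 brings two gaps at once. -/

lemma rpow_neg_pos {q : ℕ} (hq : 0 < q) (r : ℝ) : 0 < (q : ℝ) ^ (-r) :=
  Real.rpow_pos_of_pos (by exact_mod_cast hq) _

lemma rpow_neg_anti {p q : ℕ} (hp : 0 < p) (hpq : p ≤ q) {r : ℝ} (hr : 0 ≤ r) :
    (q : ℝ) ^ (-r) ≤ (p : ℝ) ^ (-r) :=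
  Real.rpow_le_rpow_of_nonpos (by exact_mod_cast hp) (by exact_mod_cast hpq) (by linarith)

lemma rpow_neg_le_inv {q : ℕ} (hq : 1 ≤ q) {r : ℝ} (hr : 1 < r) :
    (q : ℝ) ^ (-r) ≤ 1 / q := by
  have h := Real.rpow_le_rpow_of_exponent_le (x := (q : ℝ)) (by exact_mod_cast hq)
    (show -r ≤ -1 by linarith)
  rwa [Real.rpow_neg_one, ← one_div] at h

lemma rpow_neg_le_half {q : ℕ} (hq : 2 ≤ q) {r : ℝ} (hr : 1 < r) :
    (q : ℝ) ^ (-r) ≤ 1 / 2 :=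
  (rpow_neg_le_inv (by omega) hr).trans
    (one_div_le_one_div_of_le (by norm_num) (by exact_mod_cast hq))

/-! ### Tails of the Euler product. -/

/-- The Euler factor at `q` of the product over the primes exceeding `k`. -/
noncomputable def eulerFactor (r : ℝ) (k q : ℕ) : ℝ :=
  open Classical in if q.Prime ∧ k < q then 1 / (1 - (q : ℝ) ^ (-r)) else 1

/-- The tail `∏_{q > k} 1 / (1 - q^{-r})` of the Euler product. -/
noncomputable def eulerTail (r : ℝ) (k : ℕ) : ℝ := ∏' q, eulerFactor r k q

lemma eulerFactor_of_prime {r : ℝ} {k q : ℕ} (hq : q.Prime) (hk : k < q) :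
    eulerFactor r k q = 1 / (1 - (q : ℝ) ^ (-r)) := if_pos ⟨hq, hk⟩

lemma eulerFactor_of_le {r : ℝ} {k q : ℕ} (hk : q ≤ k) : eulerFactor r k q = 1 :=
  if_neg fun h => by omega

lemma eulerFactor_of_not_prime {r : ℝ} {k q : ℕ} (hq : ¬ q.Prime) : eulerFactor r k q = 1 :=
  if_neg fun h => hq h.1

lemma tprod_eq_eulerTail (r : ℝ) (k : ℕ) :
    ∏' q : {q : ℕ // q.Prime ∧ k < q}, 1 / (1 - (q : ℝ) ^ (-r)) = eulerTail r k := by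
  classical
  rw [eulerTail]
  have h := tprod_subtype {q : ℕ | q.Prime ∧ k < q} fun q : ℕ => 1 / (1 - (q : ℝ) ^ (-r))
  refine h.trans (tprod_congr fun q => ?_)
  simp [Set.mulIndicator, eulerFactor]

lemma isMighty_iff {r : ℝ} {p : ℕ} :
    IsMighty r p ↔ p.Prime ∧ eulerTail r p < 1 + (p : ℝ) ^ (-r) := by
  rw [IsMighty, tprod_eq_eulerTail]

lemma one_add_le_eulerFactor {r : ℝ} (hr : 1 < r) {k q : ℕ} (hq : q.Prime) (hk : k < q) :
    1 + (q : ℝ) ^ (-r) ≤ eulerFactor r k q := by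
  have h1 := rpow_neg_le_half hq.two_le hr
  have h0 := rpow_neg_pos hq.pos r
  rw [eulerFactor_of_prime hq hk, le_div_iff₀ (by linarith)]
  nlinarith

lemma one_le_eulerFactor {r : ℝ} (hr : 1 < r) (k q : ℕ) : 1 ≤ eulerFactor r k q := by
  by_cases h : q.Prime ∧ k < q
  · linarith [one_add_le_eulerFactor hr h.1 h.2, rpow_neg_pos h.1.pos r]
  · rw [eulerFactor, if_neg h]

lemma multipliable_eulerFactor {r : ℝ} (hr : 1 < r) (k : ℕ) : Multipliable (eulerFactor r k) := by
  -- The factor 2 comes from x / (1 - x) ≤ 2x for x ≤ 1/2.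
  have hs : Summable fun q : ℕ => 2 * (q : ℝ) ^ (-r) :=
    (Real.summable_nat_rpow.2 (by linarith)).mul_left 2
  have hs' : Summable fun q => eulerFactor r k q - 1 := by
    refine Summable.of_nonneg_of_le (fun q => ?_) (fun q => ?_) hs
    · linarith [one_le_eulerFactor hr k q]
    · by_cases h : q.Prime ∧ k < q
      · have h1 := rpow_neg_le_half h.1.two_le hr
        have h0 := rpow_neg_pos h.1.pos r
        rw [eulerFactor_of_prime h.1 h.2, sub_le_iff_le_add, div_le_iff₀ (by linarith)]
        nlinarith
      · rw [eulerFactor, if_neg h]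
        have := Real.rpow_nonneg (Nat.cast_nonneg (α := ℝ) q) (-r)
        linarith
  have := Real.multipliable_one_add_of_summable hs'
  simpa using this

lemma hasProd_eulerFactor {r : ℝ} (hr : 1 < r) (k : ℕ) :
    HasProd (eulerFactor r k) (eulerTail r k) :=
  (multipliable_eulerFactor hr k).hasProd

lemma prod_le_eulerTail {r : ℝ} (hr : 1 < r) (k : ℕ) (F : Finset ℕ) :
    ∏ q ∈ F, eulerFactor r k q ≤ eulerTail r k := by
  refine ge_of_tendsto (hasProd_eulerFactor hr k) ?_
  filter_upwards [eventually_ge_atTop F] with G hG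
  exact Finset.prod_le_prod_of_subset_of_one_le hG
    (fun q _ => zero_le_one.trans (one_le_eulerFactor hr k q))
    (fun q _ _ => one_le_eulerFactor hr k q)

lemma one_le_eulerTail {r : ℝ} (hr : 1 < r) (k : ℕ) : 1 ≤ eulerTail r k := by
  simpa using prod_le_eulerTail hr k ∅

lemma eulerTail_le_of_prod_range_le {r : ℝ} (hr : 1 < r) {k : ℕ} {B : ℝ}
    (h : ∀ N, ∏ q ∈ Finset.range N, eulerFactor r k q ≤ B) : eulerTail r k ≤ B :=
  le_of_tendsto' (hasProd_eulerFactor hr k).tendsto_prod_nat h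

/-- Together with `one_sub_sum_le_prod`, these are the Weierstrass product inequalities; they turn
estimates of prime sums into lower and upper bounds for Euler tails. -/
lemma one_add_sum_le_prod {ι : Type*} (s : Finset ι) {f : ι → ℝ} (hf : ∀ i ∈ s, 0 ≤ f i) :
    1 + ∑ i ∈ s, f i ≤ ∏ i ∈ s, (1 + f i) := by
  classical
  induction s using Finset.induction_on with
  | empty => simp
  | insert a s ha ih =>
    rw [Finset.sum_insert ha, Finset.prod_insert ha]
    have h1 := ih fun i hi => hf i (Finset.mem_insert_of_mem hi)
    have h2 := hf a (Finset.mem_insert_self a s)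
    have h3 := Finset.sum_nonneg fun i hi => hf i (Finset.mem_insert_of_mem hi)
    nlinarith

lemma one_sub_sum_le_prod {ι : Type*} (s : Finset ι) {f : ι → ℝ}
    (hf : ∀ i ∈ s, 0 ≤ f i ∧ f i ≤ 1) : 1 - ∑ i ∈ s, f i ≤ ∏ i ∈ s, (1 - f i) := by
  classical
  induction s using Finset.induction_on with
  | empty => simp
  | insert a s ha ih =>
    rw [Finset.sum_insert ha, Finset.prod_insert ha]
    have h1 := ih fun i hi => hf i (Finset.mem_insert_of_mem hi)
    have h2 := hf a (Finset.mem_insert_self a s)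
    have h3 := Finset.sum_nonneg fun i hi => (hf i (Finset.mem_insert_of_mem hi)).1
    nlinarith

/-- Removing the prime `p` from the Euler product. -/
lemma eulerTail_eq_of_prime {r : ℝ} (hr : 1 < r) {k p : ℕ} (hp : p.Prime) (hk : k < p)
    (hkp : ∀ q, q.Prime → k < q → p ≤ q) :
    eulerTail r k = 1 / (1 - (p : ℝ) ^ (-r)) * eulerTail r p := by
  have h1 := hasProd_single (f := fun q => if q = p then 1 / (1 - (p : ℝ) ^ (-r)) else 1) p
    (fun q hq => if_neg hq)
  rw [if_pos rfl] at h1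
  have h2 := h1.mul (hasProd_eulerFactor hr p)
  refine HasProd.unique (hasProd_eulerFactor hr k) (h2.congr_fun ?_)
  intro q
  by_cases hq : q.Prime
  · rcases lt_trichotomy q p with hqp | rfl | hqp
    · have : q ≤ k := by
        by_contra hh
        exact absurd (hkp q hq (by omega)) (by omega)
      simp [eulerFactor_of_le this, eulerFactor_of_le hqp.le, hqp.ne]
    · simp [eulerFactor_of_prime hq hk, eulerFactor_of_le le_rfl]
    · simp [eulerFactor_of_prime hq hqp, eulerFactor_of_prime hq (hk.trans hqp), hqp.ne']
  · have : q ≠ p := fun h => hq (h ▸ hp)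
    simp [eulerFactor_of_not_prime hq, this]

lemma eulerTail_succ_of_not_prime {r : ℝ} {k : ℕ} (hk : ¬ (k + 1).Prime) :
    eulerTail r k = eulerTail r (k + 1) := by
  refine tprod_congr fun q => ?_
  by_cases hq : q.Prime
  · have : q ≠ k + 1 := fun h => hk (h ▸ hq)
    by_cases hqk : q ≤ k
    · rw [eulerFactor_of_le hqk, eulerFactor_of_le (by omega)]
    · rw [eulerFactor_of_prime hq (by omega), eulerFactor_of_prime hq (by omega)]
  · rw [eulerFactor_of_not_prime hq, eulerFactor_of_not_prime hq]

lemma eulerTail_succ_of_prime {r : ℝ} (hr : 1 < r) {k : ℕ} (hk : (k + 1).Prime) :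
    eulerTail r k = 1 / (1 - ((k + 1 : ℕ) : ℝ) ^ (-r)) * eulerTail r (k + 1) :=
  eulerTail_eq_of_prime hr hk (by omega) fun q _ h => h

lemma eulerTail_zero_eq {r : ℝ} (hr : 1 < r) (k : ℕ) :
    eulerTail r 0 = (∏ q ∈ Finset.range (k + 1), eulerFactor r 0 q) * eulerTail r k := by
  induction k with
  | zero => simp [eulerFactor_of_le le_rfl]
  | succ k ih =>
    rw [Finset.prod_range_succ, ih, mul_assoc]
    congr 1
    by_cases hk : (k + 1).Prime
    · rw [eulerTail_succ_of_prime hr hk, eulerFactor_of_prime hk (by omega)]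
    · rw [eulerTail_succ_of_not_prime hk, eulerFactor_of_not_prime hk, one_mul]

/-- The tail is the full product divided by a partial product, and the partial products converge to
the full one. -/
lemma tendsto_eulerTail {r : ℝ} (hr : 1 < r) : Tendsto (eulerTail r) atTop (𝓝 1) := by
  have h := ((hasProd_eulerFactor hr 0).tendsto_prod_nat).comp (tendsto_add_atTop_nat 1)
  have h0 : eulerTail r 0 ≠ 0 := (zero_lt_one.trans_le (one_le_eulerTail hr 0)).ne'
  have h2 := (tendsto_const_nhds (x := eulerTail r 0)).div h h0
  rw [div_self h0] at h2
  refine h2.congr fun k => ?_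
  have hpos : 0 < ∏ q ∈ Finset.range (k + 1), eulerFactor r 0 q :=
    Finset.prod_pos fun q _ => zero_lt_one.trans_le (one_le_eulerFactor hr 0 q)
  simp only [Pi.div_apply, Function.comp]
  rw [div_eq_iff hpos.ne', mul_comm]
  exact eulerTail_zero_eq hr k

/-- A sum of `q^{-r}` over primes `q > k` bounds the Euler tail from below. -/
lemma one_add_sum_le_eulerTail {r : ℝ} (hr : 1 < r) {k : ℕ} {F : Finset ℕ}
    (hF : ∀ q ∈ F, q.Prime ∧ k < q) :
    1 + ∑ q ∈ F, (q : ℝ) ^ (-r) ≤ eulerTail r k := by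
  refine (one_add_sum_le_prod F fun q hq => ?_).trans
    ((Finset.prod_le_prod (fun q hq => ?_) fun q hq => ?_).trans (prod_le_eulerTail hr k F))
  · exact (rpow_neg_pos (hF q hq).1.pos r).le
  · linarith [rpow_neg_pos (hF q hq).1.pos r]
  · exact one_add_le_eulerFactor hr (hF q hq).1 (hF q hq).2

/-- A bound on the sums of `q^{-r}` over primes `q > k` bounds the Euler tail from above. -/
lemma eulerTail_le_of_sum_le {r : ℝ} (hr : 1 < r) {k : ℕ} {s : ℝ} (hs : s < 1)
    (h : ∀ N, ∑ q ∈ Finset.range N with q.Prime ∧ k < q, (q : ℝ) ^ (-r) ≤ s) :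
    eulerTail r k ≤ 1 / (1 - s) := by
  refine eulerTail_le_of_prod_range_le hr fun N => ?_
  have h1 := one_sub_sum_le_prod ((Finset.range N).filter fun q => q.Prime ∧ k < q)
    (f := fun q : ℕ => (q : ℝ) ^ (-r)) fun q hq =>
      ⟨Real.rpow_nonneg q.cast_nonneg _, (rpow_neg_le_half
        (Finset.mem_filter.1 hq).2.1.two_le hr).trans (by norm_num)⟩
  have h2 : ∏ q ∈ Finset.range N, eulerFactor r k q
      = 1 / ∏ q ∈ Finset.range N with q.Prime ∧ k < q, (1 - (q : ℝ) ^ (-r)) := by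
    rw [one_div, ← Finset.prod_inv_distrib, Finset.prod_filter]
    refine Finset.prod_congr rfl fun q _ => ?_
    simp [eulerFactor]
  rw [h2]
  refine one_div_le_one_div_of_le (by linarith) ?_
  linarith [h N]

/-! ### Multiplicativity and size of the divisor function. -/

lemma sigmaNeg_one (r : ℝ) : sigmaNeg r 1 = 1 := by simp [sigmaNeg]

lemma sigmaNeg_mul (r : ℝ) {a b : ℕ} (hab : a.Coprime b) :
    sigmaNeg r (a * b) = sigmaNeg r a * sigmaNeg r b := by
  unfold sigmaNeg
  rw [Nat.divisors_mul, Finset.mul_def,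
    Finset.sum_image fun i hi j hj => hab.mul_injOn_divisors hi hj,
    Finset.sum_product, Finset.sum_mul_sum]
  refine Finset.sum_congr rfl fun i _ => Finset.sum_congr rfl fun j _ => ?_
  rw [Nat.cast_mul, Real.mul_rpow i.cast_nonneg j.cast_nonneg]

lemma sigmaNeg_prime_pow (r : ℝ) {p : ℕ} (hp : p.Prime) (i : ℕ) :
    sigmaNeg r (p ^ i) = ∑ j ∈ Finset.range (i + 1), ((p : ℝ) ^ (-r)) ^ j := by
  rw [sigmaNeg, Nat.sum_divisors_prime_pow hp]
  refine Finset.sum_congr rfl fun j _ => ?_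
  rw [Nat.cast_pow, ← Real.rpow_natCast, ← Real.rpow_natCast, ← Real.rpow_mul p.cast_nonneg,
    ← Real.rpow_mul p.cast_nonneg, mul_comm]

lemma sigmaNeg_prime {r : ℝ} {p : ℕ} (hp : p.Prime) :
    sigmaNeg r p = 1 + (p : ℝ) ^ (-r) := by
  have h := sigmaNeg_prime_pow r hp 1
  simpa [Finset.sum_range_succ] using h

lemma sigmaNeg_le_of_dvd {r : ℝ} {a b : ℕ} (hb : b ≠ 0) (h : a ∣ b) :
    sigmaNeg r a ≤ sigmaNeg r b :=
  Finset.sum_le_sum_of_subset_of_nonneg (Nat.divisors_subset_of_dvd hb h)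
    fun d _ _ => Real.rpow_nonneg d.cast_nonneg _

lemma one_le_sigmaNeg (r : ℝ) {n : ℕ} (hn : n ≠ 0) : 1 ≤ sigmaNeg r n := by
  have := sigmaNeg_le_of_dvd (r := r) hn (one_dvd n)
  rwa [sigmaNeg_one] at this

lemma geom_sum_lt {x : ℝ} (h0 : 0 < x) (h1 : x < 1) (i : ℕ) :
    ∑ j ∈ Finset.range i, x ^ j < 1 / (1 - x) := by
  rw [geom_sum_eq h1.ne, ← neg_div_neg_eq, neg_sub, neg_sub]
  exact div_lt_div_of_pos_right (by linarith [pow_pos h0 i]) (by linarith)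

lemma tendsto_geom_sum {x : ℝ} (h0 : 0 < x) (h1 : x < 1) :
    Tendsto (fun i => ∑ j ∈ Finset.range (i + 1), x ^ j) atTop (𝓝 (1 / (1 - x))) := by
  rw [one_div]
  exact ((hasSum_geometric_of_lt_one h0.le h1).tendsto_sum_nat).comp (tendsto_add_atTop_nat 1)

/-- The sums over integers all of whose prime factors exceed `k` are at most the Euler tail. -/
lemma sigmaNeg_le_eulerTail {r : ℝ} (hr : 1 < r) {k n : ℕ} (hn : n ≠ 0)
    (h : ∀ q, q.Prime → q ∣ n → k < q) : sigmaNeg r n ≤ eulerTail r k := by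
  rw [Nat.multiplicative_factorization (sigmaNeg r) (fun a b hab => sigmaNeg_mul r hab)
    (sigmaNeg_one r) hn]
  refine le_trans ?_ (prod_le_eulerTail hr k n.primeFactors)
  refine Finset.prod_le_prod (fun q hq => ?_) fun q hq => ?_
  · exact Finset.sum_nonneg fun d _ => Real.rpow_nonneg d.cast_nonneg _
  · have hq' := Nat.prime_of_mem_primeFactors hq
    rw [eulerFactor_of_prime hq' (h q hq' (Nat.dvd_of_mem_primeFactors hq))]
    beta_reduce
    rw [sigmaNeg_prime_pow r hq']
    have := rpow_neg_le_half hq'.two_le hr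
    exact (geom_sum_lt (rpow_neg_pos hq'.pos r) (by linarith) _).le

/-! ### Greedy approximation by rough integers. -/

/-- The closure of the values at positive integers all of whose prime factors exceed `k`. -/
def roughClosure (r : ℝ) (k : ℕ) : Set ℝ :=
  closure (sigmaNeg r '' {n : ℕ | 0 < n ∧ ∀ q, q.Prime → q ∣ n → k < q})

lemma roughClosure_zero (r : ℝ) : roughClosure r 0 = sigmaClosure r := by
  unfold roughClosure sigmaClosure
  congr 2
  ext n
  exact ⟨fun h => h.1, fun h => ⟨h, fun _ hq _ => hq.pos⟩⟩

lemma roughClosure_anti (r : ℝ) {k l : ℕ} (h : k ≤ l) : roughClosure r l ⊆ roughClosure r k :=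
  closure_mono (Set.image_mono fun _ hn => ⟨hn.1, fun q hq hd => h.trans_lt (hn.2 q hq hd)⟩)

lemma mul_mem_roughClosure {r : ℝ} {k p : ℕ} (hp : p.Prime) (hk : k < p) (i : ℕ) {t : ℝ}
    (ht : t ∈ roughClosure r p) :
    (∑ j ∈ Finset.range (i + 1), ((p : ℝ) ^ (-r)) ^ j) * t ∈ roughClosure r k := by
  rw [← sigmaNeg_prime_pow r hp]
  refine map_mem_closure (f := fun t => sigmaNeg r (p ^ i) * t) (by fun_prop) ht ?_
  rintro _ ⟨n, ⟨hn0, hn⟩, rfl⟩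
  refine ⟨p ^ i * n, ⟨Nat.mul_pos (pow_pos hp.pos i) hn0, fun q hq hd => ?_⟩, ?_⟩
  · rcases (hq.dvd_mul).1 hd with h | h
    · rwa [(Nat.prime_dvd_prime_iff_eq hq hp).1 (hq.dvd_of_dvd_pow h)]
    · exact hk.trans (hn q hq h)
  · refine sigmaNeg_mul r (Nat.Coprime.pow_left i ((Nat.Prime.coprime_iff_not_dvd hp).2 ?_))
    exact fun h => lt_irrefl _ (hn p hp h)

/-- The closure of the values at positive integers with all prime factors in `(k, N]`. -/
def boundedClosure (r : ℝ) (k N : ℕ) : Set ℝ :=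
  closure (sigmaNeg r '' {n : ℕ | 0 < n ∧ ∀ q, q.Prime → q ∣ n → k < q ∧ q ≤ N})

lemma boundedClosure_mono (r : ℝ) (k : ℕ) {M N : ℕ} (h : M ≤ N) :
    boundedClosure r k M ⊆ boundedClosure r k N :=
  closure_mono (Set.image_mono fun _ hn =>
    ⟨hn.1, fun q hq hd => ⟨(hn.2 q hq hd).1, (hn.2 q hq hd).2.trans h⟩⟩)

lemma boundedClosure_subset (r : ℝ) (k N : ℕ) : boundedClosure r k N ⊆ roughClosure r k :=
  closure_mono (Set.image_mono fun _ hn => ⟨hn.1, fun q hq hd => (hn.2 q hq hd).1⟩)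

lemma mul_mem_boundedClosure {r : ℝ} {k N : ℕ} (hp : (N + 1).Prime) (hk : k ≤ N) (i : ℕ) {t : ℝ}
    (ht : t ∈ boundedClosure r k N) :
    (∑ j ∈ Finset.range (i + 1), (((N + 1 : ℕ) : ℝ) ^ (-r)) ^ j) * t
      ∈ boundedClosure r k (N + 1) := by
  rw [← sigmaNeg_prime_pow r hp]
  refine map_mem_closure (f := fun t => sigmaNeg r ((N + 1) ^ i) * t) (by fun_prop) ht ?_
  rintro _ ⟨n, ⟨hn0, hn⟩, rfl⟩
  refine ⟨(N + 1) ^ i * n, ⟨Nat.mul_pos (pow_pos hp.pos i) hn0, fun q hq hd => ?_⟩, ?_⟩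
  · rcases (hq.dvd_mul).1 hd with h | h
    · have := (Nat.prime_dvd_prime_iff_eq hq hp).1 (hq.dvd_of_dvd_pow h)
      omega
    · have := hn q hq h
      omega
  · refine sigmaNeg_mul r (Nat.Coprime.pow_left i ((Nat.Prime.coprime_iff_not_dvd hp).2 ?_))
    intro h
    have := hn _ hp h
    omega

/-- Greedy invariant: a is built from primes up to N, and what is still missing, x / a, lies in [1,
P_N]. At a new prime the largest partial geometric sum not overshooting x is used; non-mightiness
keeps the remaining factor within the next tail. -/
lemma exists_mem_boundedClosure {r : ℝ} (hr : 1 < r) {k : ℕ}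
    (hm : ∀ p, p.Prime → k < p → ¬ IsMighty r p) {x : ℝ} (hx : x ∈ Set.Icc 1 (eulerTail r k))
    {N : ℕ} (hN : k ≤ N) : ∃ a ∈ boundedClosure r k N, 0 < a ∧ a ≤ x ∧ x ≤ a * eulerTail r N := by
  induction N, hN using Nat.le_induction with
  | base =>
    refine ⟨1, subset_closure ⟨1, ⟨one_pos, fun q hq h => absurd (Nat.dvd_one.1 h) hq.one_lt.ne'⟩,
      sigmaNeg_one r⟩, one_pos, hx.1, ?_⟩
    rw [one_mul]; exact hx.2
  | succ N hN ih =>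
    obtain ⟨a, ha, ha0, hax, hxa⟩ := ih
    by_cases hp : (N + 1).Prime
    · set y := ((N + 1 : ℕ) : ℝ) ^ (-r) with hy
      have hy0 : 0 < y := rpow_neg_pos hp.pos r
      have hy1 : y < 1 := by linarith [rpow_neg_le_half hp.two_le hr]
      have hP := eulerTail_succ_of_prime hr hp
      have hP1 := one_le_eulerTail hr (N + 1)
      rw [← hy] at hP
      have hnm : 1 + y ≤ eulerTail r (N + 1) := by
        have := hm _ hp (by omega)
        rw [isMighty_iff, not_and, not_lt] at this
        exact this hp
      have hlim : Tendsto (fun i => (∑ j ∈ Finset.range (i + 1), y ^ j) * a) atTop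
        (𝓝 (1 / (1 - y) * a)) := (tendsto_geom_sum hy0 hy1).mul_const a
      by_cases hu : 1 / (1 - y) * a ≤ x
      -- Every exponent undershoots, so the exponent is taken to be infinite; the closure contains
      -- this limit.
      · refine ⟨1 / (1 - y) * a, isClosed_closure.mem_of_tendsto hlim (Eventually.of_forall
          fun i => mul_mem_boundedClosure hp hN i ha), ?_, hu, ?_⟩
        · have : 0 < 1 - y := by linarith
          positivity
        · rw [hP] at hxa
          linarith
      · rw [not_le] at hu
        have hex : ∃ i, x < (∑ j ∈ Finset.range (i + 1), y ^ j) * a :=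
          (hlim.eventually (lt_mem_nhds hu)).exists
        classical
        obtain ⟨i, hi, hlt⟩ : ∃ i, x < (∑ j ∈ Finset.range (i + 1 + 1), y ^ j) * a ∧
            (∑ j ∈ Finset.range (i + 1), y ^ j) * a ≤ x := by
          have hf := Nat.find_spec hex
          have h0 : Nat.find hex ≠ 0 := by
            intro h0
            rw [h0] at hf
            simp at hf
            linarith
          obtain ⟨i, hi⟩ := Nat.exists_eq_succ_of_ne_zero h0
          refine ⟨i, by rwa [hi] at hf, not_lt.1 (Nat.find_min hex (by omega))⟩
        have hs1 : 1 ≤ ∑ j ∈ Finset.range (i + 1), y ^ j := by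
          rw [Finset.sum_range_succ']
          have := Finset.sum_nonneg (s := Finset.range i) (f := fun j => y ^ (j + 1))
            fun j _ => by positivity
          simp only [pow_zero]
          linarith
        refine ⟨_, mul_mem_boundedClosure hp hN i ha, by positivity, hlt, hi.le.trans ?_⟩
        rw [Finset.sum_range_succ]
        have hpow : y ^ (i + 1) ≤ y := by
          simpa using pow_le_pow_of_le_one hy0.le hy1.le (show 1 ≤ i + 1 by omega)
        -- With S ≥ 1 the current sum, S + y^{i+1} ≤ S + y ≤ S(1 + y), and 1 + y is at most the next
        -- tail because the prime is not mighty.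
        have h2 : (∑ j ∈ Finset.range (i + 1), y ^ j) + y ^ (i + 1)
            ≤ (∑ j ∈ Finset.range (i + 1), y ^ j) * eulerTail r (N + 1) := by
          nlinarith
        calc _ ≤ ((∑ j ∈ Finset.range (i + 1), y ^ j) * eulerTail r (N + 1)) * a :=
              mul_le_mul_of_nonneg_right h2 ha0.le
          _ = _ := by ring
    · refine ⟨a, boundedClosure_mono r k N.le_succ ha, ha0, hax, ?_⟩
      rwa [← eulerTail_succ_of_not_prime hp]

/-- If no prime exceeding `k` is mighty, the closure over `k`-rough integers is an interval. -/
lemma Icc_subset_roughClosure {r : ℝ} (hr : 1 < r) {k : ℕ}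
    (hm : ∀ p, p.Prime → k < p → ¬ IsMighty r p) :
    Set.Icc 1 (eulerTail r k) ⊆ roughClosure r k := by
  intro x hx
  choose! a ha ha0 hax hxa using fun N (hN : k ≤ N) => exists_mem_boundedClosure hr hm hx hN
  have hlim : Tendsto (fun N => x / eulerTail r N) atTop (𝓝 (x / 1)) :=
    tendsto_const_nhds.div (tendsto_eulerTail hr) one_ne_zero
  rw [div_one] at hlim
  have ht : Tendsto a atTop (𝓝 x) := by
    refine tendsto_of_tendsto_of_tendsto_of_le_of_le' hlim tendsto_const_nhds ?_ ?_
    · filter_upwards [eventually_ge_atTop k] with N hN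
      rw [div_le_iff₀ (zero_lt_one.trans_le (one_le_eulerTail hr N))]
      exact hxa N hN
    · filter_upwards [eventually_ge_atTop k] with N hN using hax N hN
  refine isClosed_closure.mem_of_tendsto ht ?_
  filter_upwards [eventually_ge_atTop k] with N hN
  exact boundedClosure_subset r k N (ha N hN)

/-! ### Counting components of subsets of the line. -/

/-- Send each component to the index of a piece it meets. Two components meeting the same
preconnected piece coincide, so this map is injective. -/
lemma card_connectedComponents_le {X : Type*} [TopologicalSpace X] {S : Set X} {n : ℕ}
    (T : Fin n → Set X) (hT : ∀ i, IsPreconnected (T i)) (hS : S = ⋃ i, T i) :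
    ENat.card (ConnectedComponents S) ≤ n := by
  have hex : ∀ c : ConnectedComponents S, ∃ i, ∃ s : S,
      (s : ConnectedComponents S) = c ∧ (s : X) ∈ T i := by
    intro c
    obtain ⟨s, rfl⟩ := ConnectedComponents.surjective_coe c
    obtain ⟨i, hi⟩ := Set.mem_iUnion.1 (hS ▸ s.2 : (s : X) ∈ ⋃ i, T i)
    exact ⟨i, s, rfl, hi⟩
  choose f g hg hf using hex
  have hinj : Function.Injective f := by
    intro c d hcd
    have hsub : T (f c) ⊆ S := hS ▸ Set.subset_iUnion T (f c)
    have hpre : IsPreconnected ((↑) ⁻¹' T (f c) : Set S) := by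
      rw [← Topology.IsInducing.subtypeVal.isPreconnected_image, Subtype.image_preimage_coe,
        Set.inter_eq_right.2 hsub]
      exact hT _
    have hd : (g d : X) ∈ T (f c) := hcd ▸ hf d
    rw [← hg c, ← hg d, ConnectedComponents.coe_eq_coe']
    exact hpre.subset_connectedComponent hd (hf c)
  have := ENat.card_le_card_of_injective hinj
  simpa using this

/-- A component containing two of the points would, as a connected subset of ℝ, contain the missing
point c between them. -/
lemma le_card_connectedComponents {S : Set ℝ} {n : ℕ} (s : Fin (n + 1) → ℝ) (hs : ∀ i, s i ∈ S)
    (hgap : ∀ i : Fin n, ∃ c ∉ S, s i.castSucc < c ∧ c < s i.succ) :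
    ((n + 1 : ℕ) : ℕ∞) ≤ ENat.card (ConnectedComponents S) := by
  have hmono : StrictMono s := Fin.strictMono_iff_lt_succ.2 fun i => by
    obtain ⟨c, -, h1, h2⟩ := hgap i
    exact h1.trans h2
  have hne : ∀ i j, i < j →
      ((⟨s i, hs i⟩ : S) : ConnectedComponents S) ≠
        ((⟨s j, hs j⟩ : S) : ConnectedComponents S) := by
    intro i j hij h
    obtain ⟨c, hcS, hic, hcj⟩ : ∃ c ∉ S, s i < c ∧ c < s j := by
      obtain ⟨c, hc, h1, h2⟩ := hgap (i.castPred (Fin.ne_last_of_lt hij))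
      refine ⟨c, hc, by simpa using h1, h2.trans_le (hmono.monotone ?_)⟩
      rw [Fin.le_def]
      simpa using hij
    rw [ConnectedComponents.coe_eq_coe'] at h
    have hpre : IsPreconnected ((↑) '' connectedComponent (⟨s j, hs j⟩ : S) : Set ℝ) :=
      isPreconnected_connectedComponent.image _ continuous_subtype_val.continuousOn
    have := hpre.Icc_subset ⟨_, h, rfl⟩ ⟨_, mem_connectedComponent, rfl⟩ ⟨hic.le, hcj.le⟩
    obtain ⟨t, -, rfl⟩ := this
    exact hcS t.2
  have hinj : Function.Injective
      fun i => ((⟨s i, hs i⟩ : S) : ConnectedComponents S) := by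
    intro i j hij
    rcases lt_trichotomy i j with h | h | h
    · exact absurd hij (hne i j h)
    · exact h
    · exact absurd hij.symm (hne j i h)
  have := ENat.card_le_card_of_injective hinj
  simpa using this

/-! ### Filling intervals by geometric multiples. -/

/-- The multiples of `[s, q]` by `1 + x`, `1 + x + x ^ 2`, … fill an interval when consecutive
ones overlap. -/
lemma Icc_subset_of_geom_mul {x s q : ℝ} {t : ℕ} (h0 : 0 < x) (h1 : x < 1) (hs : 0 < s) {U : Set ℝ}
    (hU : IsClosed U)
    (h : ∀ i, ∀ v ∈ Set.Icc s q, (∑ j ∈ Finset.range (i + t + 1), x ^ j) * v ∈ U)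
    (hc : 1 / (1 - x) * s ≤ (∑ j ∈ Finset.range (t + 1), x ^ j) * q) :
    Set.Icc ((∑ j ∈ Finset.range (t + 1), x ^ j) * s) (1 / (1 - x) * q) ⊆ U := by
  set a : ℕ → ℝ := fun i => ∑ j ∈ Finset.range (i + t + 1), x ^ j with ha
  have ha0 : a 0 = ∑ j ∈ Finset.range (t + 1), x ^ j := by simp [ha]
  have hapos : ∀ i, 0 < a i := fun i => Finset.sum_pos (fun j _ => pow_pos h0 j) (by simp)
  have hlt : ∀ i, a i < 1 / (1 - x) := fun i => geom_sum_lt h0 h1 _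
  have hlim : Tendsto a atTop (𝓝 (1 / (1 - x))) :=
    (tendsto_geom_sum h0 h1).comp (tendsto_add_atTop_nat t)
  have hq : 0 < q := by
    have h2 : 0 < a 0 * q := by
      rw [ha0]
      refine lt_of_lt_of_le (mul_pos ?_ hs) hc
      have : 0 < 1 - x := by linarith
      positivity
    exact pos_of_mul_pos_right h2 (hapos 0).le
  rw [← ha0] at hc ⊢
  rintro u ⟨hu1, hu2⟩
  have key : ∀ i, a i * s ≤ u → u ≤ a i * q → u ∈ U := by
    intro i hi1 hi2
    have := h i (u / a i) ⟨by rw [le_div_iff₀ (hapos i)]; linarith,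
      by rw [div_le_iff₀ (hapos i)]; linarith⟩
    rwa [mul_div_cancel₀ _ (hapos i).ne'] at this
  by_cases hu3 : u ≤ a 0 * q
  · exact key 0 hu1 hu3
  · rw [not_le] at hu3
    rcases hu2.lt_or_eq with hu2 | rfl
    -- Any multiple whose right end passes u contains u: its left end satisfies a i * s < s / (1 -
    -- x) ≤ a 0 * q < u.
    · obtain ⟨i, hi⟩ := ((hlim.mul_const q).eventually (lt_mem_nhds hu2)).exists
      refine key i ?_ hi.le
      nlinarith [hlt i]
    · refine hU.mem_of_tendsto (hlim.mul_const q) (Eventually.of_forall fun i => h i q ⟨?_, le_rfl⟩)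
      by_contra hsq
      rw [not_le] at hsq
      have h2 := mul_lt_mul_of_pos_right (hlt 0) hs
      have h3 := mul_lt_mul_of_pos_left hsq (hapos 0)
      linarith

/-! ### Power comparisons for r ≤ 5/2 and the overlap inequalities. -/

lemma div_rpow_mul_rpow_neg {a b : ℝ} (ha : 0 < a) (hb : 0 < b) (r : ℝ) :
    (a / b) ^ r * a ^ (-r) = b ^ (-r) := by
  rw [Real.div_rpow ha.le hb.le, Real.rpow_neg ha.le, Real.rpow_neg hb.le]
  have := Real.rpow_pos_of_pos ha r
  field_simp

/-- Comparison of powers with exponent at most `m / n` through a rational certificate. -/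
lemma mul_rpow_neg_le {a b c r : ℝ} {m n : ℕ} (ha : 0 < a) (hab : a ≤ b) (hn : n ≠ 0)
    (h : c ^ n ≤ (a / b) ^ m) (hr : r * n ≤ m) : c * a ^ (-r) ≤ b ^ (-r) := by
  have hb := ha.trans_le hab
  rw [← div_rpow_mul_rpow_neg ha hb r]
  refine mul_le_mul_of_nonneg_right ?_ (Real.rpow_nonneg ha.le _)
  have h0 : 0 < a / b := div_pos ha hb
  have h1 : a / b ≤ 1 := (div_le_one hb).2 hab
  refine le_of_pow_le_pow_left₀ hn (Real.rpow_nonneg h0.le r) (h.trans ?_)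
  rw [← Real.rpow_natCast, ← Real.rpow_natCast, ← Real.rpow_mul h0.le]
  exact Real.rpow_le_rpow_of_exponent_ge h0 h1 hr

/-- Comparison of powers with exponent at least `m / n` through a rational certificate. -/
lemma rpow_neg_le_mul {a b c r : ℝ} {m n : ℕ} (ha : 0 < a) (hab : a ≤ b) (hn : n ≠ 0) (hc : 0 ≤ c)
    (h : (a / b) ^ m ≤ c ^ n) (hr : m ≤ r * n) : b ^ (-r) ≤ c * a ^ (-r) := by
  have hb := ha.trans_le hab
  rw [← div_rpow_mul_rpow_neg ha hb r]
  refine mul_le_mul_of_nonneg_right ?_ (Real.rpow_nonneg ha.le _)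
  have h0 : 0 < a / b := div_pos ha hb
  have h1 : a / b ≤ 1 := (div_le_one hb).2 hab
  refine le_of_pow_le_pow_left₀ hn hc (le_trans ?_ h)
  rw [← Real.rpow_natCast, ← Real.rpow_natCast, ← Real.rpow_mul h0.le]
  exact Real.rpow_le_rpow_of_exponent_ge h0 h1 hr

lemma rpow_neg_pow (a : ℕ) (r : ℝ) (k : ℕ) : ((a : ℝ) ^ (-r)) ^ k = ((a ^ k : ℕ) : ℝ) ^ (-r) := by
  rw [Nat.cast_pow, ← Real.rpow_natCast, ← Real.rpow_natCast, ← Real.rpow_mul a.cast_nonneg,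
    ← Real.rpow_mul a.cast_nonneg, mul_comm]

/-- The inequalities between `2^{-r}`, `3^{-r}`, `5^{-r}` and `7^{-r}` valid for `1 < r ≤ 5/2`. -/
structure PowerBounds (x y z w : ℝ) : Prop where
  w_pos : 0 < w
  w_le : w ≤ z
  z_le : z ≤ y
  y_le : y ≤ x
  x_le_half : x ≤ 1 / 2
  y_le_third : y ≤ 1 / 3
  x_cube_le : x ^ 3 ≤ w
  y_sq_le : y ^ 2 ≤ w
  x_sq_le : x ^ 2 ≤ y
  x_sq_le_add : x ^ 2 ≤ z + 2 * w
  y_le_add : y ≤ x ^ 2 + z + 2 * w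
  z_le_add_cube : z ≤ 2 * w + 4 / 7 * x ^ 3
  z_le_add_sq : z ≤ 2 * w + 3 / 4 * y ^ 2

/-- In the last four bounds every term is compared with one base power (4, 3 or 5 to the -r),
reading x^2, x^3, y^2 as powers of 4, 8, 9. The ratios (a/b)^r are smallest at r = 5/2, where the
decimals c are certified by c^2 ≤ (a/b)^5. -/
lemma powerBounds {r : ℝ} (hr : 1 < r) (hr2 : r ≤ 5 / 2) :
    PowerBounds ((2 : ℕ) ^ (-r)) ((3 : ℕ) ^ (-r)) ((5 : ℕ) ^ (-r)) ((7 : ℕ) ^ (-r)) := by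
  have hr' : r * (2 : ℕ) ≤ (5 : ℕ) := by push_cast; linarith
  have hr0 : 0 ≤ r := by linarith
  constructor
  · exact rpow_neg_pos (by norm_num) r
  · exact rpow_neg_anti (by norm_num) (by norm_num) hr0
  · exact rpow_neg_anti (by norm_num) (by norm_num) hr0
  · exact rpow_neg_anti (by norm_num) (by norm_num) hr0
  · exact_mod_cast rpow_neg_le_inv (q := 2) (by norm_num) hr
  · exact_mod_cast rpow_neg_le_inv (q := 3) (by norm_num) hr
  · rw [rpow_neg_pow]
    exact rpow_neg_anti (by norm_num) (by norm_num) hr0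
  · rw [rpow_neg_pow]
    exact rpow_neg_anti (by norm_num) (by norm_num) hr0
  · rw [rpow_neg_pow]
    exact rpow_neg_anti (by norm_num) (by norm_num) hr0
  · rw [rpow_neg_pow]
    have h1 := mul_rpow_neg_le (a := 4) (b := 5) (c := 0.57) (r := r) (m := 5) (n := 2)
      (by norm_num) (by norm_num) (by norm_num) (by norm_num) hr'
    have h2 := mul_rpow_neg_le (a := 4) (b := 7) (c := 0.24) (r := r) (m := 5) (n := 2)
      (by norm_num) (by norm_num) (by norm_num) (by norm_num) hr'
    have h3 := rpow_neg_pos (q := 4) (by norm_num) r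
    norm_num at h1 h2 h3 ⊢
    linarith
  · rw [rpow_neg_pow]
    have h0 := mul_rpow_neg_le (a := 3) (b := 4) (c := 0.487) (r := r) (m := 5) (n := 2)
      (by norm_num) (by norm_num) (by norm_num) (by norm_num) hr'
    have h1 := mul_rpow_neg_le (a := 3) (b := 5) (c := 0.278) (r := r) (m := 5) (n := 2)
      (by norm_num) (by norm_num) (by norm_num) (by norm_num) hr'
    have h2 := mul_rpow_neg_le (a := 3) (b := 7) (c := 0.12) (r := r) (m := 5) (n := 2)
      (by norm_num) (by norm_num) (by norm_num) (by norm_num) hr'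
    have h3 := rpow_neg_pos (q := 3) (by norm_num) r
    norm_num at h0 h1 h2 h3 ⊢
    linarith
  · rw [rpow_neg_pow]
    have h1 := mul_rpow_neg_le (a := 5) (b := 8) (c := 0.3) (r := r) (m := 5) (n := 2)
      (by norm_num) (by norm_num) (by norm_num) (by norm_num) hr'
    have h2 := mul_rpow_neg_le (a := 5) (b := 7) (c := 0.431) (r := r) (m := 5) (n := 2)
      (by norm_num) (by norm_num) (by norm_num) (by norm_num) hr'
    have h3 := rpow_neg_pos (q := 5) (by norm_num) r
    norm_num at h1 h2 h3 ⊢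
    linarith
  · rw [rpow_neg_pow]
    have h1 := mul_rpow_neg_le (a := 5) (b := 9) (c := 0.22) (r := r) (m := 5) (n := 2)
      (by norm_num) (by norm_num) (by norm_num) (by norm_num) hr'
    have h2 := mul_rpow_neg_le (a := 5) (b := 7) (c := 0.431) (r := r) (m := 5) (n := 2)
      (by norm_num) (by norm_num) (by norm_num) (by norm_num) hr'
    have h3 := rpow_neg_pos (q := 5) (by norm_num) r
    norm_num at h1 h2 h3 ⊢
    linarith

/-- Multiples of a set by the partial geometric sums of ratio `x`, starting from `1 + x`, cover
an interval when the gap `(p, 1 + y)` of the set is filled by neighbouring multiples. -/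
lemma Icc_subset_of_gap {x y p q : ℝ} (h0 : 0 < x) (h1 : x < 1) (hy : 0 ≤ y) {U : Set ℝ}
    (hU : IsClosed U)
    (h : ∀ i, ∀ v ∈ Set.Icc 1 p ∪ Set.Icc (1 + y) q, (∑ j ∈ Finset.range (i + 1), x ^ j) * v ∈ U)
    (hp : 1 + x + x ^ 2 ≤ (1 + x) * p) (hp' : (1 + x) * (1 + y) ≤ (1 + x + x ^ 2) * p)
    (hq : 1 / (1 - x) * (1 + y) ≤ (1 + x) * q) :
    Set.Icc (1 + x) (1 / (1 - x) * q) ⊆ U := by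
  rintro u ⟨hu1, hu2⟩
  have key : ∀ i, ∀ c > 0, c = ∑ j ∈ Finset.range (i + 1), x ^ j → c * 1 ≤ u → u ≤ c * p →
      u ∈ U := by
    intro i c hc hci hl hr
    have := h i (u / c) (Or.inl ⟨by rw [le_div_iff₀ hc]; linarith,
      by rw [div_le_iff₀ hc]; linarith⟩)
    rwa [← hci, mul_div_cancel₀ _ hc.ne'] at this
  by_cases c1 : u ≤ (1 + x) * p
  · exact key 1 (1 + x) (by linarith) (by simp [Finset.sum_range_succ]) (by linarith) c1
  by_cases c2 : u ≤ (1 + x + x ^ 2) * p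
  · exact key 2 (1 + x + x ^ 2) (by positivity) (by simp [Finset.sum_range_succ])
      (by linarith) c2
  have hs : ∑ j ∈ Finset.range (1 + 1), x ^ j = 1 + x := by simp [Finset.sum_range_succ]
  refine Icc_subset_of_geom_mul (t := 1) (s := 1 + y) (q := q) h0 h1 (by linarith) hU
    (fun i v hv => h (i + 1) v (Or.inr hv)) (by rwa [hs]) ⟨?_, hu2⟩
  rw [hs]
  linarith

/-- Lower bounds for the Euler tail beyond `5` when `7` is not mighty. -/
lemma le_eulerTail_five {r : ℝ} (hr : 1 < r) (h7 : ¬ IsMighty r 7) :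
    1 + 2 * ((7 : ℕ) : ℝ) ^ (-r) ≤ eulerTail r 5 := by
  have hp : Nat.Prime 7 := by norm_num
  have hP := eulerTail_eq_of_prime hr hp (show 5 < 7 by norm_num) fun q hq h => by
    by_contra hlt
    obtain rfl : q = 6 := by omega
    exact absurd hq (by norm_num)
  rw [isMighty_iff, not_and, not_lt] at h7
  have h7 := h7 hp
  have h1 := rpow_neg_le_half hp.two_le hr
  have h0 := rpow_neg_pos hp.pos r
  rw [hP]
  generalize ((7 : ℕ) : ℝ) ^ (-r) = w at *
  rw [one_div, inv_mul_eq_div, le_div_iff₀ (by linarith)]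
  nlinarith

lemma eulerTail_three {r : ℝ} (hr : 1 < r) :
    eulerTail r 3 = 1 / (1 - ((5 : ℕ) : ℝ) ^ (-r)) * eulerTail r 5 :=
  eulerTail_eq_of_prime hr (by norm_num) (by norm_num) fun q hq h => by
    by_contra hlt
    obtain rfl : q = 4 := by omega
    exact absurd hq (by norm_num)

lemma eulerTail_two {r : ℝ} (hr : 1 < r) :
    eulerTail r 2 = 1 / (1 - ((3 : ℕ) : ℝ) ^ (-r)) * eulerTail r 3 :=
  eulerTail_eq_of_prime hr (by norm_num) (by norm_num) fun q hq h => h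

lemma eulerTail_zero {r : ℝ} (hr : 1 < r) :
    eulerTail r 0 = 1 / (1 - ((2 : ℕ) : ℝ) ^ (-r)) * eulerTail r 2 :=
  eulerTail_eq_of_prime hr (by norm_num) (by norm_num) fun q hq h => hq.two_le

/-- The inequalities used to fill the gaps, with `p`, `q`, `s` the Euler tails beyond `5`, `3`
and `2`. -/
lemma gap_inequalities {x y z w p q s : ℝ} (h : PowerBounds x y z w) (hp : 1 + 2 * w ≤ p)
    (hq : q = 1 / (1 - z) * p) (hs : s = 1 / (1 - y) * q) :
    1 / (1 - z) ≤ (1 + z) * p ∧ (1 + y + y ^ 2 ≤ (1 + y) * p ∧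
    (1 + y) * (1 + z) ≤ (1 + y + y ^ 2) * p ∧ 1 / (1 - y) * (1 + z) ≤ (1 + y) * q) ∧
    1 + x ^ 2 ≤ q ∧ (1 + x + x ^ 2) * (1 + z) ≤ (1 + x + x ^ 2 + x ^ 3) * p ∧
    (1 + x + x ^ 2 + x ^ 3) * (1 + z) ≤ (1 + x + x ^ 2) * q ∧
    (1 + x) * (1 + y) ≤ (1 + x + x ^ 2 + x ^ 3) * q ∧
    1 / (1 - x) * (1 + y) ≤ (1 + x) * s := by
  obtain ⟨hw, hwz, hzy, hyx, hx2, hy3, hx3, hyy, hxx, f2, f3, f4, f7⟩ := h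
  have hz : 0 < z := by linarith
  have hy : 0 < y := by linarith
  have hx : 0 < x := by linarith
  have hx4 : x ^ 2 ≤ 1 / 4 := by
    have := pow_le_pow_left₀ hx.le hx2 2
    norm_num at this ⊢
    exact this
  have hzz : z ^ 2 ≤ w := (pow_le_pow_left₀ hz.le hzy 2).trans hyy
  have hp0 : 0 ≤ p := by linarith
  have hsmall : ∀ v : ℝ, v ≤ w → v ≤ 1 / 4 → 1 ≤ (1 - v) * p := by
    intro v hv hv4
    have h1 : (1 - v) * (1 + 2 * w) ≤ (1 - v) * p := mul_le_mul_of_nonneg_left hp (by linarith)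
    have h2 : 0 ≤ (1 / 2 - v) * w := mul_nonneg (by linarith) hw.le
    linarith
  have hqz : (1 + z) * p ≤ q := by
    rw [hq, one_div, inv_mul_eq_div, le_div_iff₀ (by linarith)]
    linarith [mul_nonneg (sq_nonneg z) hp0]
  have hsq : (1 - y) * s = q := by
    rw [hs]
    field_simp [show 1 - y ≠ 0 by linarith]
  have hqq : 1 + z + 2 * w ≤ q := by
    linarith [mul_le_mul_of_nonneg_left hp (show 0 ≤ 1 + z by linarith), mul_pos hz hw]
  have hq2 : 1 + x ^ 2 ≤ q := by linarith
  refine ⟨?_, ⟨?_, ?_, ?_⟩, hq2, ?_, ?_, ?_, ?_⟩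
  · rw [div_le_iff₀ (by linarith)]
    linarith [hsmall (z ^ 2) hzz (by linarith [pow_le_pow_left₀ hz.le (hzy.trans hyx) 2])]
  · linarith [mul_le_mul_of_nonneg_left hp (show 0 ≤ 1 + y by linarith), mul_pos hy hw]
  -- The 3/4 is the inverse of 1 + y at the extreme y = 1/3.
  · have h1 : (1 + y) * z ≤ (1 + y) * (2 * w + 3 / 4 * y ^ 2) :=
      mul_le_mul_of_nonneg_left f7 (by linarith)
    have h2 : 0 ≤ (1 / 3 - y) * y ^ 2 := mul_nonneg (by linarith) (sq_nonneg y)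
    have h3 : 0 ≤ y ^ 2 * w := mul_nonneg (sq_nonneg y) hw.le
    have h4 : (1 + y + y ^ 2) * (1 + 2 * w) ≤ (1 + y + y ^ 2) * p :=
      mul_le_mul_of_nonneg_left hp (by positivity)
    linarith
  · rw [one_div, inv_mul_eq_div, div_le_iff₀ (by linarith)]
    have hy4 : y ^ 2 ≤ 1 / 4 := (pow_le_pow_left₀ hy.le hyx 2).trans hx4
    have h2 : (1 + z) * 1 ≤ (1 + z) * ((1 - y ^ 2) * p) :=
      mul_le_mul_of_nonneg_left (hsmall _ hyy hy4) (by linarith)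
    have h3 : (1 - y ^ 2) * ((1 + z) * p) ≤ (1 - y ^ 2) * q :=
      mul_le_mul_of_nonneg_left hqz (by linarith)
    linarith
  · have h1 : (1 + x + x ^ 2) * z ≤ (1 + x + x ^ 2) * (2 * w + 4 / 7 * x ^ 3) :=
      mul_le_mul_of_nonneg_left f4 (by positivity)
    -- The 7/4 bounds 1 + x + x^2 for x ≤ 1/2, matching the 4/7 in `z_le_add_cube`.
    have h2 : (1 + x + x ^ 2) * x ^ 3 ≤ 7 / 4 * x ^ 3 :=
      mul_le_mul_of_nonneg_right (by linarith) (by positivity)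
    have h3 : 0 ≤ x ^ 3 * w := mul_nonneg (by positivity) hw.le
    have h4 : (1 + x + x ^ 2 + x ^ 3) * (1 + 2 * w) ≤ (1 + x + x ^ 2 + x ^ 3) * p :=
      mul_le_mul_of_nonneg_left hp (by positivity)
    linarith
  · have h0 : (1 + x + x ^ 2) * (1 + 2 * w) ≤ (1 + x + x ^ 2) * p :=
      mul_le_mul_of_nonneg_left hp (by positivity)
    have h1 : 0 ≤ (x + x ^ 2) * w := by positivity
    have h2 : (1 + x + x ^ 2 + x ^ 3) * (1 + z) ≤ ((1 + x + x ^ 2) * p) * (1 + z) :=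
      mul_le_mul_of_nonneg_right (by linarith) (by linarith)
    have h3 := mul_le_mul_of_nonneg_left hqz (show 0 ≤ 1 + x + x ^ 2 by positivity)
    linarith
  · have h1 : 1 + y ≤ (1 + x ^ 2) * q := by
      have := mul_nonneg (sq_nonneg x) (show 0 ≤ q - 1 by linarith)
      linarith
    have h2 := mul_le_mul_of_nonneg_left h1 (show 0 ≤ 1 + x by linarith)
    linarith
  · rw [one_div, inv_mul_eq_div, div_le_iff₀ (by linarith)]
    have h1 : (1 - x ^ 2) * (1 + x ^ 2) ≤ (1 - x ^ 2) * q :=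
      mul_le_mul_of_nonneg_left hq2 (by linarith)
    have h2 : (x ^ 2) ^ 2 ≤ y ^ 2 := pow_le_pow_left₀ (sq_nonneg x) hxx 2
    have h4 : (1 - y) * (1 + y) ≤ (1 - y) * ((1 - x ^ 2) * s) := by
      rw [← hsq] at h1
      linarith
    have := le_of_mul_le_mul_left h4 (by linarith)
    linarith

/-! ### At most five components when no prime above 5 is mighty. -/

lemma lt_of_prime_dvd_of_not_dvd {n k p q : ℕ} (h : ∀ q, q.Prime → q ∣ n → k < q)
    (hp : ∀ q, q.Prime → k < q → q ≤ p → q = p) (hn : ¬ p ∣ n) (hq : q.Prime) (hd : q ∣ n) :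
    p < q := by
  by_contra hle
  exact hn (hp q hq (h q hq hd) (not_lt.1 hle) ▸ hd)

lemma one_add_le_sigmaNeg {r : ℝ} {p n : ℕ} (hp : p.Prime) (hn : n ≠ 0) (h : p ∣ n) :
    1 + (p : ℝ) ^ (-r) ≤ sigmaNeg r n := by
  rw [← sigmaNeg_prime hp]
  exact sigmaNeg_le_of_dvd hn h

lemma eq_five_of_prime {q : ℕ} (hq : q.Prime) (h3 : 3 < q) (h5 : q ≤ 5) : q = 5 := by
  by_contra h
  obtain rfl : q = 4 := by omega
  exact absurd hq (by norm_num)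

/-- The values at odd integers lie in three intervals. -/
lemma sigmaNeg_mem_of_odd {r : ℝ} (hr : 1 < r) {n : ℕ} (hn : n ≠ 0) (h2 : ¬ 2 ∣ n) :
    sigmaNeg r n ∈ Set.Icc 1 (eulerTail r 5) ∨
    sigmaNeg r n ∈ Set.Icc (1 + ((5 : ℕ) : ℝ) ^ (-r)) (eulerTail r 3) ∨
    sigmaNeg r n ∈ Set.Icc (1 + ((3 : ℕ) : ℝ) ^ (-r)) (eulerTail r 2) := by
  have hq2 : ∀ q, q.Prime → q ∣ n → 2 < q := fun q hq hd =>
    lt_of_prime_dvd_of_not_dvd (k := 0) (fun q hq _ => hq.pos)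
      (fun q hq _ h => le_antisymm h hq.two_le) h2 hq hd
  by_cases h3 : 3 ∣ n
  · exact Or.inr (Or.inr ⟨one_add_le_sigmaNeg (by norm_num) hn h3,
      sigmaNeg_le_eulerTail hr hn hq2⟩)
  have hq3 : ∀ q, q.Prime → q ∣ n → 3 < q := fun q hq hd =>
    lt_of_prime_dvd_of_not_dvd hq2 (fun q _ h h' => le_antisymm h' h) h3 hq hd
  by_cases h5 : 5 ∣ n
  · exact Or.inr (Or.inl ⟨one_add_le_sigmaNeg (by norm_num) hn h5,
      sigmaNeg_le_eulerTail hr hn hq3⟩)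
  · exact Or.inl ⟨one_le_sigmaNeg r hn, sigmaNeg_le_eulerTail hr hn fun q hq hd =>
      lt_of_prime_dvd_of_not_dvd hq3 (fun q hq h h' => eq_five_of_prime hq h h') h5 hq hd⟩

lemma Icc_subset_of_mul {c p s q : ℝ} {T U : Set ℝ} (hc : 0 < c) (hT : Set.Icc s q ⊆ T)
    (h : ∀ t ∈ T, c * t ∈ U) (hp : p = c * q) : Set.Icc (c * s) p ⊆ U := by
  rintro u ⟨h1, h2⟩
  have := h (u / c) (hT ⟨by rw [le_div_iff₀ hc]; linarith, by rw [div_le_iff₀ hc]; linarith⟩)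
  rwa [mul_div_cancel₀ _ hc.ne'] at this

/-- The closure contains five intervals. -/
lemma Icc_subset_sigmaClosure {r : ℝ} (hr : 1 < r) (hr2 : r ≤ 5 / 2)
    (hm : ∀ p, p.Prime → 5 < p → ¬ IsMighty r p) :
    Set.Icc 1 (eulerTail r 5) ⊆ sigmaClosure r ∧
    Set.Icc (1 + ((5 : ℕ) : ℝ) ^ (-r)) (eulerTail r 3) ⊆ sigmaClosure r ∧
    Set.Icc (1 + ((3 : ℕ) : ℝ) ^ (-r)) (eulerTail r 2) ⊆ sigmaClosure r ∧
    Set.Icc (1 + ((2 : ℕ) : ℝ) ^ (-r)) ((1 + ((2 : ℕ) : ℝ) ^ (-r)) * eulerTail r 5)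
      ⊆ sigmaClosure r ∧
    Set.Icc ((1 + ((2 : ℕ) : ℝ) ^ (-r)) * (1 + ((5 : ℕ) : ℝ) ^ (-r))) (eulerTail r 0)
      ⊆ sigmaClosure r := by
  have hB := powerBounds hr hr2
  have hp := le_eulerTail_five hr (hm 7 (by norm_num) (by norm_num))
  have hP3 := eulerTail_three hr
  have hP2 := eulerTail_two hr
  have hP0 := eulerTail_zero hr
  have h5 : ∀ i, ∀ t ∈ roughClosure r 5, _ := fun i t ht =>
    mul_mem_roughClosure (r := r) (k := 3) (show Nat.Prime 5 by norm_num) (by norm_num) i ht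
  have h3 : ∀ i, ∀ t ∈ roughClosure r 3, _ := fun i t ht =>
    mul_mem_roughClosure (r := r) (k := 2) (show Nat.Prime 3 by norm_num) (by norm_num) i ht
  have h2 : ∀ i, ∀ t ∈ roughClosure r 2, _ := fun i t ht =>
    mul_mem_roughClosure (r := r) (k := 0) (show Nat.Prime 2 by norm_num) (by norm_num) i ht
  obtain ⟨g0, ⟨g1, g2, g3⟩, g4, g5, g6, g7, g8⟩ := gap_inequalities hB hp hP3 hP2
  obtain ⟨hw, hwz, hzy, hyx, hx2, hy3, -, -, -, -, -, -, -⟩ := hB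
  generalize ((2 : ℕ) : ℝ) ^ (-r) = x at *
  generalize ((3 : ℕ) : ℝ) ^ (-r) = y at *
  generalize ((5 : ℕ) : ℝ) ^ (-r) = z at *
  generalize ((7 : ℕ) : ℝ) ^ (-r) = w at *
  have hz : 0 < z := by linarith
  have hy : 0 < y := by linarith
  have hx : 0 < x := by linarith
  rw [← roughClosure_zero]
  have k5 : Set.Icc 1 (eulerTail r 5) ⊆ roughClosure r 5 := Icc_subset_roughClosure hr hm
  have k53 := roughClosure_anti r (show 3 ≤ 5 by norm_num)
  have k32 := roughClosure_anti r (show 2 ≤ 3 by norm_num)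
  have k20 := roughClosure_anti r (show 0 ≤ 2 by norm_num)
  have k3 : Set.Icc (1 + z) (eulerTail r 3) ⊆ roughClosure r 3 := by
    have h := Icc_subset_of_geom_mul (x := z) (s := 1) (q := eulerTail r 5) (t := 1) hz
      (by linarith) one_pos (U := roughClosure r 3) isClosed_closure
      (fun i v hv => h5 (i + 1) v (k5 hv))
    simp only [Finset.sum_range_succ, Finset.sum_range_zero, pow_zero, pow_one, mul_one,
      zero_add] at h
    rw [hP3]
    exact h g0
  have k2 : Set.Icc (1 + y) (eulerTail r 2) ⊆ roughClosure r 2 := by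
    rw [hP2]
    refine Icc_subset_of_gap hy (by linarith) hz.le isClosed_closure (fun i v hv => h3 i v ?_)
      g1 g2 g3
    exact hv.elim (fun h => k53 (k5 h)) fun h => k3 h
  have e1 : ∑ j ∈ Finset.range (1 + 1), x ^ j = 1 + x := by simp [Finset.sum_range_succ]
  have e2 : ∑ j ∈ Finset.range (2 + 1), x ^ j = 1 + x + x ^ 2 := by simp [Finset.sum_range_succ]
  have e3 : ∑ j ∈ Finset.range (3 + 1), x ^ j = 1 + x + x ^ 2 + x ^ 3 := by
    simp [Finset.sum_range_succ]
  have c1 : ∀ t ∈ roughClosure r 2, (1 + x) * t ∈ roughClosure r 0 := fun t ht => e1 ▸ h2 1 t ht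
  have c2 : ∀ t ∈ roughClosure r 2, (1 + x + x ^ 2) * t ∈ roughClosure r 0 :=
    fun t ht => e2 ▸ h2 2 t ht
  have c3 : ∀ t ∈ roughClosure r 2, (1 + x + x ^ 2 + x ^ 3) * t ∈ roughClosure r 0 :=
    fun t ht => e3 ▸ h2 3 t ht
  refine ⟨fun u hu => k20 (k32 (k53 (k5 hu))), fun u hu => k20 (k32 (k3 hu)),
    fun u hu => k20 (k2 hu), ?_, ?_⟩
  · have := Icc_subset_of_mul (by linarith) (fun u hu => k32 (k53 (k5 hu))) c1 rfl
    rwa [mul_one] at this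
  -- Overlapping chain, with σ(n) the value at n: σ(2)·[1+z, P_3], σ(8)·[1, P_5], σ(4)·[1+z, P_3],
  -- σ(8)·[1+z, P_3], then all σ(2^i)·[1+y, P_2] with i ≥ 1.
  · rintro u ⟨hu1, hu2⟩
    have hx3 : 0 < x ^ 3 := pow_pos hx 3
    have hx4 : 0 < x ^ 2 := pow_pos hx 2
    by_cases d1 : u ≤ (1 + x) * eulerTail r 3
    · exact Icc_subset_of_mul (by linarith) (fun u hu => k32 (k3 hu)) c1 rfl ⟨hu1, d1⟩
    by_cases d2 : u ≤ (1 + x + x ^ 2 + x ^ 3) * eulerTail r 5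
    · refine Icc_subset_of_mul (by linarith) (fun u hu => k32 (k53 (k5 hu))) c3 rfl ⟨?_, d2⟩
      have := mul_le_mul_of_nonneg_left g4 (show 0 ≤ 1 + x by linarith)
      linarith
    by_cases d3 : u ≤ (1 + x + x ^ 2) * eulerTail r 3
    · exact Icc_subset_of_mul (by linarith) (fun u hu => k32 (k3 hu)) c2 rfl ⟨by linarith, d3⟩
    by_cases d4 : u ≤ (1 + x + x ^ 2 + x ^ 3) * eulerTail r 3
    · exact Icc_subset_of_mul (by linarith) (fun u hu => k32 (k3 hu)) c3 rfl ⟨by linarith, d4⟩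
    rw [hP0] at hu2
    refine Icc_subset_of_geom_mul (t := 1) hx (by linarith) (show 0 < 1 + y by linarith)
      isClosed_closure (fun i v hv => h2 (i + 1) v (k2 hv)) (by rwa [e1]) ⟨?_, hu2⟩
    rw [e1]
    linarith

/-- The claim reduces to (1 + x) 5^{-r} ≤ x^2 with x = 2^{-r}, and 5^{-r} ≤ 0.64 x^2 while 1 + x ≤
3/2. -/
lemma one_add_mul_one_add_le_sigmaNeg_four {r : ℝ} (hr : 2 ≤ r) :
    (1 + ((2 : ℕ) : ℝ) ^ (-r)) * (1 + ((5 : ℕ) : ℝ) ^ (-r)) ≤ sigmaNeg r (2 ^ 2) := by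
  have h := rpow_neg_le_mul (a := 4) (b := 5) (c := 0.64) (r := r) (m := 2) (n := 1)
    (by norm_num) (by norm_num) (by norm_num) (by norm_num) (by norm_num) (by norm_num; exact hr)
  have h4 := rpow_neg_pow 2 r 2
  have hx := rpow_neg_le_half le_rfl (show 1 < r by linarith)
  have hx0 := rpow_neg_pos two_pos r
  rw [sigmaNeg_prime_pow r Nat.prime_two]
  simp only [Finset.sum_range_succ, Finset.sum_range_zero, pow_zero, pow_one, zero_add]
  norm_num at h h4 hx hx0 ⊢
  rw [← h4] at h
  nlinarith

/-- If no prime beyond `5` is mighty, the closure is a union of five intervals. -/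
lemma numComponents_le_five {r : ℝ} (hr : 1 < r) (hr2 : r ≤ 5 / 2)
    (hm : ∀ p, p.Prime → 5 < p → ¬ IsMighty r p) : numComponents r ≤ 5 := by
  obtain ⟨s1, s2, s3, s4, s5⟩ := Icc_subset_sigmaClosure hr hr2 hm
  have h7 := le_eulerTail_five hr (hm 7 (by norm_num) (by norm_num))
  have hB := powerBounds hr hr2
  -- Even values must avoid the space between the last two intervals. For r ≤ 2 there is no such
  -- space, since 2·7^{-r} ≥ 5^{-r}; for r ≥ 2 all multiples of 4 lie above it, leaving only n = 2m
  -- with m odd.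
  have hmerge : 1 + ((5 : ℕ) : ℝ) ^ (-r) ≤ eulerTail r 5 ∨
      (1 + ((2 : ℕ) : ℝ) ^ (-r)) * (1 + ((5 : ℕ) : ℝ) ^ (-r)) ≤ sigmaNeg r (2 ^ 2) := by
    rcases le_total r 2 with h2 | h2
    · have := mul_rpow_neg_le (a := 5) (b := 7) (c := 1 / 2) (r := r) (m := 2) (n := 1)
        (by norm_num) (by norm_num) (by norm_num) (by norm_num) (by norm_num; exact h2)
      left
      norm_num at this h7 ⊢
      linarith
    · exact Or.inr (one_add_mul_one_add_le_sigmaNeg_four h2)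
  have hx0 := rpow_neg_pos (q := 2) (by norm_num) r
  have hsub : sigmaClosure r ⊆ Set.Icc 1 (eulerTail r 5) ∪
      Set.Icc (1 + ((5 : ℕ) : ℝ) ^ (-r)) (eulerTail r 3) ∪
      Set.Icc (1 + ((3 : ℕ) : ℝ) ^ (-r)) (eulerTail r 2) ∪
      Set.Icc (1 + ((2 : ℕ) : ℝ) ^ (-r)) ((1 + ((2 : ℕ) : ℝ) ^ (-r)) * eulerTail r 5) ∪
      Set.Icc ((1 + ((2 : ℕ) : ℝ) ^ (-r)) * (1 + ((5 : ℕ) : ℝ) ^ (-r))) (eulerTail r 0) := by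
    refine closure_minimal ?_ (by
      exact ((((isClosed_Icc.union isClosed_Icc).union isClosed_Icc).union isClosed_Icc).union
        isClosed_Icc))
    rintro _ ⟨n, hn, rfl⟩
    have hn0 : n ≠ 0 := Nat.pos_iff_ne_zero.1 hn
    have htop : sigmaNeg r n ≤ eulerTail r 0 :=
      sigmaNeg_le_eulerTail hr hn0 fun q hq _ => hq.pos
    by_cases h2 : 2 ∣ n
    · have hb := one_add_le_sigmaNeg (r := r) Nat.prime_two hn0 h2
      rcases hmerge with hmerge | hmerge
      · by_cases hle : sigmaNeg r n ≤ (1 + ((2 : ℕ) : ℝ) ^ (-r)) * eulerTail r 5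
        · exact Or.inl (Or.inr ⟨hb, hle⟩)
        · refine Or.inr ⟨(mul_le_mul_of_nonneg_left hmerge (by linarith)).trans
            (not_le.1 hle).le, htop⟩
      by_cases h4 : 2 ^ 2 ∣ n
      · exact Or.inr ⟨hmerge.trans (sigmaNeg_le_of_dvd hn0 h4), htop⟩
      obtain ⟨m, rfl⟩ := h2
      have hm2 : ¬ 2 ∣ m := fun h => h4 (by rw [pow_two]; exact mul_dvd_mul_left 2 h)
      have hm0 : m ≠ 0 := by rintro rfl; simp at hm2
      rw [sigmaNeg_mul r ((Nat.Prime.coprime_iff_not_dvd Nat.prime_two).2 hm2),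
        sigmaNeg_prime Nat.prime_two] at htop hb ⊢
      have hcase : sigmaNeg r m ≤ eulerTail r 5 ∨ 1 + ((5 : ℕ) : ℝ) ^ (-r) ≤ sigmaNeg r m := by
        rcases sigmaNeg_mem_of_odd hr hm0 hm2 with h | h | h
        · exact Or.inl h.2
        · exact Or.inr h.1
        · exact Or.inr ((add_le_add_right hB.z_le 1).trans h.1)
      rcases hcase with h | h
      · exact Or.inl (Or.inr ⟨hb, mul_le_mul_of_nonneg_left h (by linarith)⟩)
      · exact Or.inr ⟨mul_le_mul_of_nonneg_left h (by linarith), htop⟩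
    · rcases sigmaNeg_mem_of_odd hr hn0 h2 with h | h | h
      · exact Or.inl (Or.inl (Or.inl (Or.inl h)))
      · exact Or.inl (Or.inl (Or.inl (Or.inr h)))
      · exact Or.inl (Or.inl (Or.inr h))
  refine card_connectedComponents_le (n := 5)
    ![Set.Icc 1 (eulerTail r 5), Set.Icc (1 + ((5 : ℕ) : ℝ) ^ (-r)) (eulerTail r 3),
      Set.Icc (1 + ((3 : ℕ) : ℝ) ^ (-r)) (eulerTail r 2),
      Set.Icc (1 + ((2 : ℕ) : ℝ) ^ (-r)) ((1 + ((2 : ℕ) : ℝ) ^ (-r)) * eulerTail r 5),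
      Set.Icc ((1 + ((2 : ℕ) : ℝ) ^ (-r)) * (1 + ((5 : ℕ) : ℝ) ^ (-r))) (eulerTail r 0)]
    (fun i => ?_) ?_
  · fin_cases i <;> exact isPreconnected_Icc
  · refine Set.Subset.antisymm (fun u hu => ?_) (Set.iUnion_subset fun i => ?_)
    · rw [Set.mem_iUnion]
      rcases hsub hu with (((h | h) | h) | h) | h
      exacts [⟨0, h⟩, ⟨1, h⟩, ⟨2, h⟩, ⟨3, h⟩, ⟨4, h⟩]
    · fin_cases i
      exacts [s1, s2, s3, s4, s5]

/-! ### The prime 7 is mighty for r ≥ 5/2. -/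

lemma rpow_neg_le_seven {r : ℝ} (hr : 5 / 2 ≤ r) (b c : ℝ) (hb : 7 ≤ b) (hc : 0 ≤ c)
    (h : (7 / b) ^ 5 ≤ c ^ 2) : b ^ (-r) ≤ c * (7 : ℝ) ^ (-r) :=
  rpow_neg_le_mul (m := 5) (n := 2) (by norm_num) hb two_ne_zero hc h (by push_cast; linarith)

/-- Trial division by 2, 3, 5, 7 detects all composites below 121, so the kernel only has to check
divisibility. -/
lemma filter_prime_range_subset : (Finset.range 101).filter (fun q => q.Prime ∧ 7 < q) ⊆
    {11, 13, 17, 19, 23, 29, 31, 37, 41, 43, 47, 53, 59, 61, 67, 71, 73, 79, 83, 89, 97} := by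
  intro q hq
  simp only [Finset.mem_filter, Finset.mem_range] at hq
  obtain ⟨hq, hp, h7⟩ := hq
  have hd : ∀ p ∈ ({2, 3, 5, 7} : Finset ℕ), ¬ p ∣ q := by
    intro p hmem hpq
    rcases hp.eq_one_or_self_of_dvd p hpq with rfl | rfl
    · simp at hmem
    · simp only [Finset.mem_insert, Finset.mem_singleton] at hmem
      omega
  have key : ∀ q < 101, 7 < q → (∀ p ∈ ({2, 3, 5, 7} : Finset ℕ), ¬ p ∣ q) →
      q ∈ ({11, 13, 17, 19, 23, 29, 31, 37, 41, 43, 47, 53, 59, 61, 67, 71, 73, 79, 83, 89,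
        97} : Finset ℕ) := by
    decide +kernel
  exact key q hq h7 hd

lemma sum_head_le {r : ℝ} (hr : 5 / 2 ≤ r) :
    ∑ q ∈ Finset.range 101 with q.Prime ∧ 7 < q, (q : ℝ) ^ (-r) ≤ 0.92 * (7 : ℝ) ^ (-r) := by
  have h11 := rpow_neg_le_seven hr 11 0.3231 (by norm_num) (by norm_num) (by norm_num)
  have h13 := rpow_neg_le_seven hr 13 0.2128 (by norm_num) (by norm_num) (by norm_num)
  have h17 := rpow_neg_le_seven hr 17 0.1088 (by norm_num) (by norm_num) (by norm_num)
  have h19 := rpow_neg_le_seven hr 19 0.0824 (by norm_num) (by norm_num) (by norm_num)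
  have h23 := rpow_neg_le_seven hr 23 0.0512 (by norm_num) (by norm_num) (by norm_num)
  have h29 := rpow_neg_le_seven hr 29 0.0287 (by norm_num) (by norm_num) (by norm_num)
  have h31 := rpow_neg_le_seven hr 31 0.0243 (by norm_num) (by norm_num) (by norm_num)
  have h37 := rpow_neg_le_seven hr 37 0.0156 (by norm_num) (by norm_num) (by norm_num)
  have h41 := rpow_neg_le_seven hr 41 0.0121 (by norm_num) (by norm_num) (by norm_num)
  have h43 := rpow_neg_le_seven hr 43 0.0107 (by norm_num) (by norm_num) (by norm_num)
  have h47 := rpow_neg_le_seven hr 47 0.0086 (by norm_num) (by norm_num) (by norm_num)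
  have h53 := rpow_neg_le_seven hr 53 0.0064 (by norm_num) (by norm_num) (by norm_num)
  have h59 := rpow_neg_le_seven hr 59 0.0049 (by norm_num) (by norm_num) (by norm_num)
  have h61 := rpow_neg_le_seven hr 61 0.0045 (by norm_num) (by norm_num) (by norm_num)
  have h67 := rpow_neg_le_seven hr 67 0.0036 (by norm_num) (by norm_num) (by norm_num)
  have h71 := rpow_neg_le_seven hr 71 0.0031 (by norm_num) (by norm_num) (by norm_num)
  have h73 := rpow_neg_le_seven hr 73 0.0029 (by norm_num) (by norm_num) (by norm_num)
  have h79 := rpow_neg_le_seven hr 79 0.0024 (by norm_num) (by norm_num) (by norm_num)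
  have h83 := rpow_neg_le_seven hr 83 0.0021 (by norm_num) (by norm_num) (by norm_num)
  have h89 := rpow_neg_le_seven hr 89 0.0018 (by norm_num) (by norm_num) (by norm_num)
  have h97 := rpow_neg_le_seven hr 97 0.0014 (by norm_num) (by norm_num) (by norm_num)
  have h0 : 0 < (7 : ℝ) ^ (-r) := by positivity
  refine (Finset.sum_le_sum_of_subset_of_nonneg filter_prime_range_subset fun q _ _ =>
    Real.rpow_nonneg q.cast_nonneg _).trans ?_
  simp only [Finset.mem_insert, Finset.mem_singleton, Finset.sum_insert,
    Finset.sum_singleton, Nat.cast_ofNat, Nat.reduceEqDiff, or_self, not_false_eq_true]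
  linarith

/-- Telescoping majorant of the tail of the sum over odd integers. -/
lemma sum_range_le {r : ℝ} (hr : 5 / 2 ≤ r) {k : ℕ} (hk : 50 ≤ k) :
    ∑ q ∈ Finset.range (2 * k + 1) with q.Prime ∧ 7 < q, (q : ℝ) ^ (-r)
      ≤ (0.97 - (147 / (128 * k) + 343 / (6 * k ^ 2))) * (7 : ℝ) ^ (-r) := by
  have h0 : 0 < (7 : ℝ) ^ (-r) := by positivity
  induction k, hk using Nat.le_induction with
  | base =>
    refine (sum_head_le hr).trans (mul_le_mul_of_nonneg_right ?_ h0.le)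
    norm_num
  | succ k hk ih =>
    have hk' : (50 : ℝ) ≤ k := by exact_mod_cast hk
    rw [show 2 * (k + 1) + 1 = 2 * k + 1 + 1 + 1 by ring, Finset.sum_filter, Finset.sum_range_succ,
      Finset.sum_range_succ, ← Finset.sum_filter]
    have heven : ¬ ((2 * k + 1 + 1).Prime ∧ 7 < 2 * k + 1 + 1) := by
      rintro ⟨hp, -⟩
      have := (Nat.prime_dvd_prime_iff_eq Nat.prime_two hp).1 ⟨k + 1, by ring⟩
      omega
    rw [if_neg heven, add_zero]
    have hodd : (if (2 * k + 1).Prime ∧ 7 < 2 * k + 1 then ((2 * k + 1 : ℕ) : ℝ) ^ (-r) else 0)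
        ≤ ((2 * k + 1 : ℕ) : ℝ) ^ (-r) := by
      split_ifs
      · exact le_rfl
      · positivity
    set t : ℝ := 7 / (2 * k + 1) with ht
    have ht0 : 0 < t := by positivity
    -- Here t^{5/2} = t^2 √t, and AM-GM gives √t ≤ (3/16 + 16t/3)/2, sharp at t = 9/256, that is
    -- near q = 199. Then (2k+1)^2 ≥ 4k(k+1) makes the t^2 and t^3 parts telescope.
    have hstep := rpow_neg_le_seven hr (2 * k + 1) (t ^ 2 * ((3 / 16 + 16 / 3 * t) / 2))
      (by linarith) (by positivity) (by
        rw [← ht]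
        nlinarith [mul_nonneg (pow_pos ht0 4).le (sq_nonneg (3 / 16 - 16 / 3 * t))])
    have htel : t ^ 2 * ((3 / 16 + 16 / 3 * t) / 2) ≤ (147 / (128 * k) + 343 / (6 * k ^ 2)) -
        (147 / (128 * (k + 1 : ℝ)) + 343 / (6 * (k + 1 : ℝ) ^ 2)) := by
      have hk0 : (0 : ℝ) < k := by linarith
      have h1 : t ^ 2 * (3 / 32) ≤ 147 / (128 * k) - 147 / (128 * (k + 1 : ℝ)) := by
        rw [ht, div_pow, div_mul_eq_mul_div, div_sub_div _ _ (by positivity) (by positivity),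
          div_le_div_iff₀ (by positivity) (by positivity)]
        nlinarith
      have h2 : t ^ 3 * (8 / 3) ≤ 343 / (6 * k ^ 2) - 343 / (6 * (k + 1 : ℝ) ^ 2) := by
        have e : (343 / (6 * k ^ 2) - 343 / (6 * (k + 1 : ℝ) ^ 2) : ℝ)
            = 343 / 6 * (2 * k + 1) / (k * (k + 1)) ^ 2 := by
          field_simp
          ring
        have h4 : 16 * ((k : ℝ) * (k + 1)) ^ 2 ≤ (2 * k + 1) ^ 4 := by
          have := pow_le_pow_left₀ (by positivity)
            (show 4 * ((k : ℝ) * (k + 1)) ≤ (2 * k + 1) ^ 2 by nlinarith) 2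
          linarith
        rw [e, ht, div_pow, div_mul_eq_mul_div, div_le_div_iff₀ (by positivity) (by positivity)]
        linarith
      linarith
    push_cast at hodd ⊢
    nlinarith [mul_le_mul_of_nonneg_right htel h0.le]

/-- The prime `7` is mighty for `r ≥ 5/2`. -/
lemma isMighty_seven {r : ℝ} (hr : 5 / 2 ≤ r) : IsMighty r 7 := by
  rw [isMighty_iff]
  refine ⟨by norm_num, ?_⟩
  have h0 : 0 < (7 : ℝ) ^ (-r) := by positivity
  have h1 := rpow_neg_le_mul (a := 1) (b := 7) (c := 1 / 49) (r := r) (m := 2) (n := 1)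
    (by norm_num) (by norm_num) (by norm_num) (by norm_num) (by norm_num) (by norm_num; linarith)
  rw [Real.one_rpow, mul_one] at h1
  have hle := eulerTail_le_of_sum_le (show 1 < r by linarith) (k := 7) (s := 0.97 * (7 : ℝ) ^ (-r))
    (by linarith) fun N => by
      have hmono : (Finset.range N).filter (fun q => q.Prime ∧ 7 < q) ⊆
          (Finset.range (2 * (N + 50) + 1)).filter (fun q => q.Prime ∧ 7 < q) :=
        Finset.filter_subset_filter _ (Finset.range_subset_range.2 (by omega))
      refine (Finset.sum_le_sum_of_subset_of_nonneg hmono fun q _ _ =>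
        Real.rpow_nonneg q.cast_nonneg _).trans ((sum_range_le hr (by omega)).trans ?_)
      refine mul_le_mul_of_nonneg_right ?_ h0.le
      have : (0 : ℝ) ≤ 147 / (128 * ((N + 50 : ℕ) : ℝ)) + 343 / (6 * ((N + 50 : ℕ) : ℝ) ^ 2) := by
        positivity
      linarith
  refine hle.trans_lt ?_
  -- With w = 7^{-r} ≤ 1/49, (1 + w)(1 - 0.97w) > 1, since 0.97(1 + w) < 1.
  rw [Nat.cast_ofNat, div_lt_iff₀ (by linarith)]
  nlinarith

/-! ### Primes that are not mighty. -/

lemma not_isMighty_of_sum {r : ℝ} (hr : 1 < r) {p : ℕ} {F : Finset ℕ}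
    (hF : ∀ q ∈ F, q.Prime ∧ p < q) (h : (p : ℝ) ^ (-r) ≤ ∑ q ∈ F, (q : ℝ) ^ (-r)) :
    ¬ IsMighty r p := by
  rw [isMighty_iff, not_and, not_lt]
  intro _
  linarith [one_add_sum_le_eulerTail hr hF]

/-- For exponents up to `3` it is enough to compare cubes. -/
lemma not_isMighty_of_sum_cube {r : ℝ} (hr : 1 < r) (hr3 : r ≤ 3) {p : ℕ} (hp : 0 < p)
    {F : Finset ℕ} (hF : ∀ q ∈ F, q.Prime ∧ p < q) (h : 1 ≤ ∑ q ∈ F, ((p : ℝ) / q) ^ 3) :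
    ¬ IsMighty r p := by
  refine not_isMighty_of_sum hr hF ?_
  have h0 := rpow_neg_pos hp r
  calc (p : ℝ) ^ (-r) ≤ (∑ q ∈ F, ((p : ℝ) / q) ^ 3) * (p : ℝ) ^ (-r) := by nlinarith
    _ = ∑ q ∈ F, ((p : ℝ) / q) ^ 3 * (p : ℝ) ^ (-r) := Finset.sum_mul _ _ _
    _ ≤ _ := Finset.sum_le_sum fun q hq => mul_rpow_neg_le (m := 3) (n := 1)
        (by exact_mod_cast hp) (by exact_mod_cast (hF q hq).2.le) one_ne_zero (by rw [pow_one])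
        (by push_cast; linarith)

/-- Enough primes in `(hi, b]` prevent the primes of `[lo, hi]` from being mighty. -/
lemma not_isMighty_of_card {r : ℝ} (hr : 1 < r) (hr3 : r ≤ 3) {p lo hi b : ℕ} (h0 : 0 < lo)
    (hb : 0 < b) (hlo : lo ≤ p) (hhi : p ≤ hi) {F : Finset ℕ}
    (hF : ∀ q ∈ F, q.Prime ∧ hi < q ∧ q ≤ b) (h : b ^ 3 ≤ F.card * lo ^ 3) : ¬ IsMighty r p := by
  refine not_isMighty_of_sum_cube hr hr3 (h0.trans_le hlo)
    (fun q hq => ⟨(hF q hq).1, hhi.trans_lt (hF q hq).2.1⟩) ?_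
  have h1 : ∀ q ∈ F, ((lo : ℝ) / b) ^ 3 ≤ ((p : ℝ) / q) ^ 3 := by
    intro q hq
    have hq0 : (0 : ℝ) < q := by exact_mod_cast (hF q hq).1.pos
    gcongr
    exact (hF q hq).2.2
  refine le_trans ?_ (Finset.card_nsmul_le_sum _ _ _ h1)
  rw [nsmul_eq_mul, div_pow, mul_div_assoc', le_div_iff₀ (by positivity), one_mul]
  exact_mod_cast h

/-- With s = √n the main term is 2 s^2 log 2 and all the losses are at most (132 + 8s) log(2s). The
logarithm is bounded by its tangent at s = 40, which explains the threshold 1600, and 80^3 ≤ 2^19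
controls log 80. -/
lemma chebyshev_inequality {n : ℕ} (hn : 1600 ≤ n) : 64 * Real.log (4 * n : ℕ) ≤
    ((4 * n : ℕ) * Real.log 2 - Real.log ((4 * n : ℕ) + 1)
      - 2 * √(4 * n : ℕ) * Real.log (4 * n : ℕ)) - Real.log 4 * n := by
  have hn' : (1600 : ℝ) ≤ n := by exact_mod_cast hn
  set s := √(n : ℝ) with hs
  have hs40 : 40 ≤ s := Real.le_sqrt_of_sq_le (by linarith)
  have hsq : (n : ℝ) = s ^ 2 := (Real.sq_sqrt (by positivity)).symm
  push_cast
  have e1 : √(4 * n : ℝ) = 2 * s := by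
    rw [hsq, show (4 * s ^ 2 : ℝ) = (2 * s) ^ 2 by ring, Real.sqrt_sq (by linarith)]
  have e2 : Real.log (4 * n) = 2 * Real.log (2 * s) := by
    rw [hsq, show (4 * s ^ 2 : ℝ) = (2 * s) ^ 2 by ring, Real.log_pow]
    norm_num
  have e3 : Real.log (4 * n + 1) ≤ 2 * Real.log (4 * n) := by
    have := Real.log_pow (4 * (n : ℝ)) 2
    push_cast at this
    rw [← this]
    exact Real.log_le_log (by linarith) (by nlinarith)
  have e4 : Real.log 4 = 2 * Real.log 2 := by
    rw [show (4 : ℝ) = 2 ^ 2 by norm_num, Real.log_pow]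
    norm_num
  have e5 : Real.log (2 * s) ≤ 19 / 3 * Real.log 2 + s / 40 - 1 := by
    have h1 : Real.log (2 * s) = Real.log 80 + Real.log (s / 40) := by
      rw [← Real.log_mul (by norm_num) (by positivity)]
      congr 1
      ring
    have h2 : 3 * Real.log 80 ≤ 19 * Real.log 2 := by
      have h := Real.log_le_log (by norm_num) (show (80 : ℝ) ^ 3 ≤ 2 ^ 19 by norm_num)
      rw [Real.log_pow, Real.log_pow] at h
      exact_mod_cast h
    have h3 := Real.log_le_sub_one_of_pos (show 0 < s / 40 by positivity)
    linarith
  have hl1 := Real.log_two_gt_d9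
  have hl2 := Real.log_two_lt_d9
  have e6 : (132 + 8 * s) * Real.log (2 * s) ≤ (132 + 8 * s) * (4.4 + s / 40 - 1) :=
    mul_le_mul_of_nonneg_left (by linarith) (by positivity)
  have e7 : s ^ 2 * 0.69 ≤ s ^ 2 * Real.log 2 := by gcongr; linarith
  rw [e2] at e3
  rw [e1, e4, e2]
  rw [hsq] at e3 ⊢
  linarith [mul_nonneg (show 0 ≤ s - 40 by linarith) (show 0 ≤ s by linarith)]

/-- Each prime in (n, 4n] adds at most log(4n) to θ(4n) - θ(n). The number 64 = 4^3 is what the cube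
criterion needs with b = 4p. -/
lemma le_card_primes {n : ℕ} (hn : 1600 ≤ n) :
    64 ≤ ((Finset.Ioc n (4 * n)).filter Nat.Prime).card := by
  have h1 := Chebyshev.theta_ge (4 * n)
  have h2 := Chebyshev.theta_le_log4_mul_x (x := n) n.cast_nonneg
  have h3 := chebyshev_inequality hn
  have hlog : 0 < Real.log (4 * n : ℕ) := Real.log_pos (by exact_mod_cast (by omega : 1 < 4 * n))
  have h4 : Chebyshev.theta (4 * n : ℕ) - Chebyshev.theta n =
      ∑ p ∈ Finset.Ioc n (4 * n) with p.Prime, Real.log p := by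
    rw [Chebyshev.theta, Chebyshev.theta, Nat.floor_natCast, Nat.floor_natCast, sub_eq_iff_eq_add,
      add_comm, Finset.sum_filter, Finset.sum_filter, Finset.sum_filter]
    exact (Finset.sum_Ioc_consecutive _ (by omega) (by omega)).symm
  have h5 : ∑ p ∈ Finset.Ioc n (4 * n) with p.Prime, Real.log p ≤
      ((Finset.Ioc n (4 * n)).filter Nat.Prime).card • Real.log (4 * n : ℕ) := by
    refine Finset.sum_le_card_nsmul _ _ _ fun p hp => ?_
    simp only [Finset.mem_filter, Finset.mem_Ioc] at hp
    exact Real.log_le_log (by exact_mod_cast hp.2.pos) (by exact_mod_cast hp.1.2)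
  rw [nsmul_eq_mul] at h5
  have h6 : (64 : ℝ) * Real.log (4 * n : ℕ) ≤
      ((Finset.Ioc n (4 * n)).filter Nat.Prime).card * Real.log (4 * n : ℕ) := by linarith
  exact_mod_cast le_of_mul_le_mul_right h6 hlog

lemma not_isMighty_of_small {r : ℝ} (hr : 1 < r) (hr3 : r ≤ 3) {p : ℕ}
    (h : p ∈ ({11, 13, 17, 19, 23} : Finset ℕ)) :
    ¬ IsMighty r p := by
  simp only [Finset.mem_insert, Finset.mem_singleton] at h
  rcases h with rfl | rfl | rfl | rfl | rfl
  · refine not_isMighty_of_sum_cube hr hr3 (by norm_num) (F := {13, 17, 19}) (by norm_num) ?_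
    norm_num
  · refine not_isMighty_of_sum_cube hr hr3 (by norm_num) (F := {17, 19, 23, 29}) (by norm_num) ?_
    norm_num
  · refine not_isMighty_of_sum_cube hr hr3 (by norm_num) (F := {19, 23}) (by norm_num) ?_
    norm_num
  · refine not_isMighty_of_sum_cube hr hr3 (by norm_num) (F := {23, 29, 31}) (by norm_num) ?_
    norm_num
  · refine not_isMighty_of_sum_cube hr hr3 (by norm_num) (F := {29, 31, 37}) (by norm_num) ?_
    norm_num

/-- A finite cover of [29, 1902] by blocks, each followed closely by enough primes; beyond it the
Chebyshev count applies. -/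
lemma not_isMighty_of_le {r : ℝ} (hr : 1 < r) (hr3 : r ≤ 3) {p : ℕ} (h29 : 29 ≤ p)
    (hp : p ≤ 1902) : ¬ IsMighty r p := by
  rcases le_or_gt p 30 with h | h
  · exact not_isMighty_of_card hr hr3 (lo := 29) (hi := 30) (b := 41) (by norm_num)
      (by norm_num) (by omega) (by omega)
      (F := {31, 37, 41})
      (by norm_num) (by norm_num)
  rcases le_or_gt p 36 with h | h
  · exact not_isMighty_of_card hr hr3 (lo := 31) (hi := 36) (b := 43) (by norm_num)
      (by norm_num) (by omega) (by omega)
      (F := {37, 41, 43})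
      (by norm_num) (by norm_num)
  rcases le_or_gt p 42 with h | h
  · exact not_isMighty_of_card hr hr3 (lo := 37) (hi := 42) (b := 53) (by norm_num)
      (by norm_num) (by omega) (by omega)
      (F := {43, 47, 53})
      (by norm_num) (by norm_num)
  rcases le_or_gt p 58 with h | h
  · exact not_isMighty_of_card hr hr3 (lo := 43) (hi := 58) (b := 73) (by norm_num)
      (by norm_num) (by omega) (by omega)
      (F := {59, 61, 67, 71, 73})
      (by norm_num) (by norm_num)
  rcases le_or_gt p 82 with h | h
  · exact not_isMighty_of_card hr hr3 (lo := 59) (hi := 82) (b := 107) (by norm_num)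
      (by norm_num) (by omega) (by omega)
      (F := {83, 89, 97, 101, 103, 107})
      (by norm_num) (by norm_num)
  rcases le_or_gt p 136 with h | h
  · exact not_isMighty_of_card hr hr3 (lo := 83) (hi := 136) (b := 199) (by norm_num)
      (by norm_num) (by omega) (by omega)
      (F := {137, 139, 149, 151, 157, 163, 167, 173, 179, 181, 191, 193, 197, 199})
      (by norm_num) (by norm_num)
  rcases le_or_gt p 256 with h | h
  · exact not_isMighty_of_card hr hr3 (lo := 137) (hi := 256) (b := 359) (by norm_num)
      (by norm_num) (by omega) (by omega)
      (F := {257, 263, 269, 271, 277, 281, 283, 293, 307, 311, 313, 317, 331, 337, 347, 349,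
      353, 359})
      (by norm_num) (by norm_num)
  rcases le_or_gt p 500 with h | h
  · exact not_isMighty_of_card hr hr3 (lo := 257) (hi := 500) (b := 587) (by norm_num)
      (by norm_num) (by omega) (by omega)
      (F := {503, 509, 521, 523, 541, 547, 557, 563, 569, 571, 577, 587})
      (by norm_num) (by norm_num)
  rcases le_or_gt p 975 with h | h
  · exact not_isMighty_of_card hr hr3 (lo := 501) (hi := 975) (b := 1031) (by norm_num)
      (by norm_num) (by omega) (by omega)
      (F := {977, 983, 991, 997, 1009, 1013, 1019, 1021, 1031})
      (by norm_num) (by norm_num)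
  exact not_isMighty_of_card hr hr3 (lo := 976) (hi := 1902) (b := 1987) (by norm_num)
      (by norm_num) (by omega) (by omega)
      (F := {1907, 1913, 1931, 1933, 1949, 1951, 1973, 1979, 1987})
      (by norm_num) (by norm_num)

/-- No prime exceeding `7` is mighty for `r ≤ 3`. -/
lemma not_isMighty_of_gt_seven {r : ℝ} (hr : 1 < r) (hr3 : r ≤ 3) {p : ℕ} (hp : p.Prime)
    (h7 : 7 < p) : ¬ IsMighty r p := by
  rcases lt_or_ge p 29 with h | h
  · have key : ∀ q < 29, 7 < q → q.Prime → q ∈ ({11, 13, 17, 19, 23} : Finset ℕ) := by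
      intro q hq hq7
      interval_cases q <;> norm_num
    exact not_isMighty_of_small hr hr3 (key p h h7 hp)
  rcases le_or_gt p 1902 with h' | h'
  · exact not_isMighty_of_le hr hr3 h h'
  refine not_isMighty_of_card hr hr3 (lo := p) (hi := p) (b := 4 * p) (by omega) (by omega) le_rfl
    le_rfl (F := (Finset.Ioc p (4 * p)).filter Nat.Prime) (fun q hq => ?_) ?_
  · simp only [Finset.mem_filter, Finset.mem_Ioc] at hq
    exact ⟨hq.2, hq.1⟩
  · rw [mul_pow]
    exact Nat.mul_le_mul_right _ (le_card_primes (by omega))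

/-- The prime `7` is not mighty for `r ≤ 9/4`. -/
lemma not_isMighty_seven {r : ℝ} (hr : 1 < r) (hr2 : r ≤ 9 / 4) : ¬ IsMighty r 7 := by
  have hr' : r * (4 : ℕ) ≤ (9 : ℕ) := by push_cast; linarith
  have h11 := mul_rpow_neg_le (a := 7) (b := 11) (c := 0.3616) (r := r) (m := 9) (n := 4)
    (by norm_num) (by norm_num) (by norm_num) (by norm_num) hr'
  have h13 := mul_rpow_neg_le (a := 7) (b := 13) (c := 0.2483) (r := r) (m := 9) (n := 4)
    (by norm_num) (by norm_num) (by norm_num) (by norm_num) hr'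
  have h17 := mul_rpow_neg_le (a := 7) (b := 17) (c := 0.1358) (r := r) (m := 9) (n := 4)
    (by norm_num) (by norm_num) (by norm_num) (by norm_num) hr'
  have h19 := mul_rpow_neg_le (a := 7) (b := 19) (c := 0.1057) (r := r) (m := 9) (n := 4)
    (by norm_num) (by norm_num) (by norm_num) (by norm_num) hr'
  have h23 := mul_rpow_neg_le (a := 7) (b := 23) (c := 0.0687) (r := r) (m := 9) (n := 4)
    (by norm_num) (by norm_num) (by norm_num) (by norm_num) hr'
  have h29 := mul_rpow_neg_le (a := 7) (b := 29) (c := 0.0408) (r := r) (m := 9) (n := 4)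
    (by norm_num) (by norm_num) (by norm_num) (by norm_num) hr'
  have h31 := mul_rpow_neg_le (a := 7) (b := 31) (c := 0.0351) (r := r) (m := 9) (n := 4)
    (by norm_num) (by norm_num) (by norm_num) (by norm_num) hr'
  have h37 := mul_rpow_neg_le (a := 7) (b := 37) (c := 0.0236) (r := r) (m := 9) (n := 4)
    (by norm_num) (by norm_num) (by norm_num) (by norm_num) hr'
  refine not_isMighty_of_sum hr (F := {11, 13, 17, 19, 23, 29, 31, 37}) (by norm_num) ?_
  have h0 : 0 < (7 : ℝ) ^ (-r) := by positivity
  simp only [Finset.mem_insert, Finset.mem_singleton, Finset.sum_insert,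
    Finset.sum_singleton, Nat.cast_ofNat, Nat.reduceEqDiff, or_self, not_false_eq_true]
  linarith

/-! ### At least seven components when 7 is mighty. -/

lemma midpoint_notMem_sigmaClosure {r a b : ℝ} (hab : a < b)
    (h : ∀ n : ℕ, 0 < n → sigmaNeg r n ≤ a ∨ b ≤ sigmaNeg r n) :
    (a + b) / 2 ∉ sigmaClosure r := by
  intro hm
  have hsub : sigmaClosure r ⊆ Set.Iic a ∪ Set.Ici b := by
    refine closure_minimal ?_ (isClosed_Iic.union isClosed_Ici)
    rintro _ ⟨n, hn, rfl⟩
    exact h n hn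
  rcases hsub hm with h | h
  · rw [Set.mem_Iic] at h; linarith
  · rw [Set.mem_Ici] at h; linarith

lemma sigmaNeg_mem_sigmaClosure (r : ℝ) {n : ℕ} (hn : 0 < n) : sigmaNeg r n ∈ sigmaClosure r :=
  subset_closure ⟨n, hn, rfl⟩

/-- Either all prime factors exceed p, or some prime q ≤ p divides n and already contributes 1 +
q^{-r} ≥ 1 + p^{-r}. -/
lemma sigmaNeg_le_or_le {r : ℝ} (hr : 1 < r) (p : ℕ) {n : ℕ} (hn : n ≠ 0) :
    sigmaNeg r n ≤ eulerTail r p ∨ 1 + (p : ℝ) ^ (-r) ≤ sigmaNeg r n := by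
  by_cases h : ∀ q, q.Prime → q ∣ n → p < q
  · exact Or.inl (sigmaNeg_le_eulerTail hr hn h)
  · push Not at h
    obtain ⟨q, hq, hd, hle⟩ := h
    right
    have := rpow_neg_anti hq.pos hle (show 0 ≤ r by linarith)
    exact (by linarith : 1 + (p : ℝ) ^ (-r) ≤ 1 + (q : ℝ) ^ (-r)).trans
      (one_add_le_sigmaNeg hq hn hd)

/-- The mighty gaps reappear multiplied by `1 + 2^{-r}`. -/
lemma sigmaNeg_le_or_le_mul {r : ℝ} (hr : 2 ≤ r) {p : ℕ} (hp : 5 ≤ p)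
    (h2 : eulerTail r 2 < 1 + ((2 : ℕ) : ℝ) ^ (-r)) {n : ℕ} (hn : n ≠ 0) :
    sigmaNeg r n ≤ (1 + ((2 : ℕ) : ℝ) ^ (-r)) * eulerTail r p ∨
      (1 + ((2 : ℕ) : ℝ) ^ (-r)) * (1 + (p : ℝ) ^ (-r)) ≤ sigmaNeg r n := by
  have hr1 : 1 < r := by linarith
  have hx0 := rpow_neg_pos two_pos r
  by_cases hd : 2 ∣ n
  · by_cases h4 : 2 ^ 2 ∣ n
    · right
      have h5 := rpow_neg_anti (show 0 < 5 by norm_num) hp (show 0 ≤ r by linarith)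
      exact (mul_le_mul_of_nonneg_left (by linarith) (by linarith)).trans
        ((one_add_mul_one_add_le_sigmaNeg_four hr).trans (sigmaNeg_le_of_dvd hn h4))
    obtain ⟨m, rfl⟩ := hd
    have hm2 : ¬ 2 ∣ m := fun h => h4 (by rw [pow_two]; exact mul_dvd_mul_left 2 h)
    have hm0 : m ≠ 0 := by rintro rfl; simp at hm2
    rw [sigmaNeg_mul r ((Nat.Prime.coprime_iff_not_dvd Nat.prime_two).2 hm2),
      sigmaNeg_prime Nat.prime_two]
    exact (sigmaNeg_le_or_le hr1 p hm0).imp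
      (fun h => mul_le_mul_of_nonneg_left h (by linarith))
      fun h => mul_le_mul_of_nonneg_left h (by linarith)
  -- Odd n stay below 1 + 2^{-r} because 2 is mighty.
  · left
    have hle : sigmaNeg r n ≤ eulerTail r 2 := by
      refine sigmaNeg_le_eulerTail hr1 hn fun q hq h => ?_
      refine lt_of_le_of_ne hq.two_le ?_
      rintro rfl
      exact hd h
    have := mul_le_mul_of_nonneg_left (one_le_eulerTail hr1 p)
      (show 0 ≤ 1 + ((2 : ℕ) : ℝ) ^ (-r) by linarith)
    linarith

/-- Mightiness passes to the preceding prime. -/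
lemma lt_one_add_of_lt_one_add {w z c p q : ℝ} (hp : p < 1 + w) (hq : q = 1 / (1 - w) * p)
    (hz : 0 ≤ z) (hwz : w ≤ c * z) (hw1 : w < 1) (hc : 2 * c ≤ 1 - w) : q < 1 + z := by
  -- Here q < (1 + w)/(1 - w) = 1 + 2w/(1 - w), and 2w ≤ 2cz ≤ (1 - w)z.
  rw [hq, one_div, inv_mul_eq_div, div_lt_iff₀ (by linarith)]
  nlinarith

lemma eulerTail_five {r : ℝ} (hr : 1 < r) :
    eulerTail r 5 = 1 / (1 - ((7 : ℕ) : ℝ) ^ (-r)) * eulerTail r 7 :=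
  eulerTail_eq_of_prime hr (by norm_num) (by norm_num) fun q hq h => by
    by_contra hlt
    obtain rfl : q = 6 := by omega
    exact absurd hq (by norm_num)

/-- If `7` is mighty then so are `5`, `3` and `2`. -/
lemma isMighty_of_isMighty_seven {r : ℝ} (hr : 1 < r) (h7 : IsMighty r 7) :
    9 / 4 < r ∧ eulerTail r 7 < 1 + ((7 : ℕ) : ℝ) ^ (-r) ∧
    eulerTail r 5 < 1 + ((5 : ℕ) : ℝ) ^ (-r) ∧ eulerTail r 3 < 1 + ((3 : ℕ) : ℝ) ^ (-r) ∧
    eulerTail r 2 < 1 + ((2 : ℕ) : ℝ) ^ (-r) := by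
  -- Passing from 7 to 5 needs 2·7^{-r} ≤ (1 - 7^{-r}) 5^{-r}. The bound r ≥ 2 only gives the ratio
  -- 25/49 > 1/2; r > 9/4 gives 0.47.
  have hr9 : 9 / 4 < r := by
    by_contra h
    exact not_isMighty_seven hr (not_lt.1 h) h7
  have t7 := (isMighty_iff.1 h7).2
  have hone : ∀ q : ℕ, 1 ≤ q → (q : ℝ) ^ (-r) ≤ 1 / (q : ℝ) ^ 2 := by
    intro q hq
    have := rpow_neg_le_mul (a := 1) (b := q) (c := 1 / (q : ℝ) ^ 2) (r := r) (m := 2) (n := 1)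
      one_pos (by exact_mod_cast hq) one_ne_zero (by positivity) (by rw [pow_one, div_pow, one_pow])
      (by push_cast; linarith)
    rwa [Real.one_rpow, mul_one] at this
  have w1 := hone 7 (by norm_num)
  have z1 := hone 5 (by norm_num)
  have y1 := hone 3 (by norm_num)
  have hr' : ((9 : ℕ) : ℝ) ≤ r * (4 : ℕ) := by push_cast; linarith
  have hr'' : ((2 : ℕ) : ℝ) ≤ r * (1 : ℕ) := by push_cast; linarith
  have wz := rpow_neg_le_mul (a := (5 : ℕ)) (b := (7 : ℕ)) (c := 0.47) (r := r)
    (by norm_num) (by norm_num) four_ne_zero (by norm_num) (by norm_num) hr'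
  have zy := rpow_neg_le_mul (a := (3 : ℕ)) (b := (5 : ℕ)) (c := 9 / 25) (r := r)
    (by norm_num) (by norm_num) one_ne_zero (by norm_num) (by norm_num) hr''
  have yx := rpow_neg_le_mul (a := (2 : ℕ)) (b := (3 : ℕ)) (c := 4 / 9) (r := r)
    (by norm_num) (by norm_num) one_ne_zero (by norm_num) (by norm_num) hr''
  have z0 := rpow_neg_pos (show 0 < 5 by norm_num) r
  have y0 := rpow_neg_pos (show 0 < 3 by norm_num) r
  have x0 := rpow_neg_pos (show 0 < 2 by norm_num) r
  have e5 := eulerTail_five hr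
  have e3 := eulerTail_three hr
  have e2 := eulerTail_two hr
  generalize ((2 : ℕ) : ℝ) ^ (-r) = x at *
  generalize ((3 : ℕ) : ℝ) ^ (-r) = y at *
  generalize ((5 : ℕ) : ℝ) ^ (-r) = z at *
  generalize ((7 : ℕ) : ℝ) ^ (-r) = w at *
  norm_num at w1 z1 y1
  have t5 := lt_one_add_of_lt_one_add t7 e5 z0.le wz (by linarith) (by linarith)
  have t3 := lt_one_add_of_lt_one_add t5 e3 y0.le zy (by linarith) (by linarith)
  exact ⟨hr9, t7, t5, t3, lt_one_add_of_lt_one_add t3 e2 x0.le yx (by linarith) (by linarith)⟩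

/-- If `7` is mighty, the closure has at least seven components. -/
lemma seven_le_numComponents {r : ℝ} (hr : 1 < r) (h7 : IsMighty r 7) : 7 ≤ numComponents r := by
  obtain ⟨hr9, t7, t5, t3, t2⟩ := isMighty_of_isMighty_seven hr h7
  have hr2 : 2 ≤ r := by linarith
  have hx0 := rpow_neg_pos two_pos r
  have c7 := midpoint_notMem_sigmaClosure t7 fun n hn => sigmaNeg_le_or_le hr 7 hn.ne'
  have c5 := midpoint_notMem_sigmaClosure t5 fun n hn => sigmaNeg_le_or_le hr 5 hn.ne'
  have c3 := midpoint_notMem_sigmaClosure t3 fun n hn => sigmaNeg_le_or_le hr 3 hn.ne'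
  have c2 := midpoint_notMem_sigmaClosure t2 fun n hn => sigmaNeg_le_or_le hr 2 hn.ne'
  have u7 := mul_lt_mul_of_pos_left t7 (show 0 < 1 + ((2 : ℕ) : ℝ) ^ (-r) by linarith)
  have u5 := mul_lt_mul_of_pos_left t5 (show 0 < 1 + ((2 : ℕ) : ℝ) ^ (-r) by linarith)
  have d7 := midpoint_notMem_sigmaClosure u7 fun n hn =>
    sigmaNeg_le_or_le_mul hr2 (by norm_num) t2 hn.ne'
  have d5 := midpoint_notMem_sigmaClosure u5 fun n hn =>
    sigmaNeg_le_or_le_mul hr2 le_rfl t2 hn.ne'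
  have b7 := one_le_eulerTail hr 7
  have tail_ge : ∀ k p : ℕ, p.Prime → k < p → 1 + (p : ℝ) ^ (-r) ≤ eulerTail r k := by
    intro k p hp hk
    simpa using one_add_sum_le_eulerTail hr (k := k) (F := {p}) (by simp [hp, hk])
  have b5 := tail_ge 5 7 (by norm_num) (by norm_num)
  have b3 := tail_ge 3 5 (by norm_num) (by norm_num)
  have b2 := tail_ge 2 3 (by norm_num) (by norm_num)
  have b7' := mul_le_mul_of_nonneg_left b7 (show 0 ≤ 1 + ((2 : ℕ) : ℝ) ^ (-r) by linarith)
  have b5' := mul_le_mul_of_nonneg_left b5 (show 0 ≤ 1 + ((2 : ℕ) : ℝ) ^ (-r) by linarith)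
  have s1 := sigmaNeg_mem_sigmaClosure r one_pos
  have s7 := sigmaNeg_mem_sigmaClosure r (show 0 < 7 by norm_num)
  have s5 := sigmaNeg_mem_sigmaClosure r (show 0 < 5 by norm_num)
  have s3 := sigmaNeg_mem_sigmaClosure r (show 0 < 3 by norm_num)
  have s2 := sigmaNeg_mem_sigmaClosure r two_pos
  have s14 := sigmaNeg_mem_sigmaClosure r (show 0 < 2 * 7 by norm_num)
  have s10 := sigmaNeg_mem_sigmaClosure r (show 0 < 2 * 5 by norm_num)
  rw [sigmaNeg_mul r (by norm_num)] at s14 s10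
  rw [sigmaNeg_prime (by norm_num)] at s7 s5 s3 s2
  rw [sigmaNeg_prime (by norm_num), sigmaNeg_prime (by norm_num)] at s14 s10
  rw [sigmaNeg_one] at s1
  generalize ((2 : ℕ) : ℝ) ^ (-r) = x at *
  generalize ((3 : ℕ) : ℝ) ^ (-r) = y at *
  generalize ((5 : ℕ) : ℝ) ^ (-r) = z at *
  generalize ((7 : ℕ) : ℝ) ^ (-r) = w at *
  -- The separated points are the values at 1, 7, 5, 3, 2, 14, 10. Each tail P_k bounding a gap from
  -- below dominates the value at the next prime, so the preceding point lies left of the gap.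
  refine le_card_connectedComponents (n := 6)
    ![1, 1 + w, 1 + z, 1 + y, 1 + x, (1 + x) * (1 + w), (1 + x) * (1 + z)] (fun i => ?_)
    fun i => ?_
  · fin_cases i
    exacts [s1, s7, s5, s3, s2, s14, s10]
  · fin_cases i
    exacts [⟨_, c7, show 1 < _ by linarith, show _ < 1 + w by linarith⟩,
      ⟨_, c5, show 1 + w < _ by linarith, show _ < 1 + z by linarith⟩,
      ⟨_, c3, show 1 + z < _ by linarith, show _ < 1 + y by linarith⟩,
      ⟨_, c2, show 1 + y < _ by linarith, show _ < 1 + x by linarith⟩,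
      ⟨_, d7, show 1 + x < _ by linarith, show _ < (1 + x) * (1 + w) by linarith⟩,
      ⟨_, d5, show (1 + x) * (1 + w) < _ by linarith, show _ < (1 + x) * (1 + z) by linarith⟩]

/-! ### Indexing of primes and conclusion. -/

/-- Two is prime number one, three is number two and five is number three. -/
lemma four_le_of_nthPrime {m : ℕ} : 4 ≤ m ↔ 1 ≤ m ∧ 5 < nthPrime m := by
  have hc : Nat.count Nat.Prime 5 = 2 := by decide
  have h5 : Nat.nth Nat.Prime 2 = 5 := by
    rw [← hc]
    exact Nat.nth_count (by norm_num)
  rw [nthPrime, ← h5, Nat.nth_lt_nth Nat.infinite_setOfPred_prime]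
  omega

/-- Every prime is some `p_m`. -/
lemma exists_nthPrime_eq {p : ℕ} (hp : p.Prime) : ∃ m, 1 ≤ m ∧ nthPrime m = p :=
  ⟨Nat.count Nat.Prime p + 1, by omega, Nat.nth_count hp⟩

end Zubrilina

theorem mainTheorem2 :
    (∀ r : ℝ, 1 < r → Zubrilina.mightyIndex r ≤ 3 → Zubrilina.numComponents r ≤ 5) ∧
    (∀ r : ℝ, 1 < r → 4 ≤ Zubrilina.mightyIndex r → 7 ≤ Zubrilina.numComponents r) ∧
    Zubrilina.IsZubrilinaNumber 6 := by
  have h1 : ∀ r : ℝ, 1 < r → Zubrilina.mightyIndex r ≤ 3 → Zubrilina.numComponents r ≤ 5 := by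
    intro r hr hL
    have hm : ∀ p, p.Prime → 5 < p → ¬ Zubrilina.IsMighty r p := by
      intro p hp h5 hmighty
      obtain ⟨m, hm1, rfl⟩ := Zubrilina.exists_nthPrime_eq hp
      have h4 : 4 ≤ m := Zubrilina.four_le_of_nthPrime.2 ⟨hm1, h5⟩
      have hle : (m : ℕ∞) ≤ Zubrilina.mightyIndex r := le_iSup₂_of_le m ⟨hm1, hmighty⟩ le_rfl
      have : (m : ℕ∞) ≤ (3 : ℕ) := hle.trans hL
      have := Nat.cast_le.1 this
      omega
    refine Zubrilina.numComponents_le_five hr ?_ hm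
    by_contra hgt
    exact hm 7 (by norm_num) (by norm_num) (Zubrilina.isMighty_seven (not_le.1 hgt).le)
  have h2 : ∀ r : ℝ, 1 < r → 4 ≤ Zubrilina.mightyIndex r → 7 ≤ Zubrilina.numComponents r := by
    intro r hr hL
    refine Zubrilina.seven_le_numComponents hr ?_
    by_contra h7
    have hr3 : r ≤ 3 := by
      by_contra h
      exact h7 (Zubrilina.isMighty_seven (by linarith))
    -- A mighty p_m with m ≥ 4 would be 7, excluded by assumption, or a larger prime, excluded for r
    -- ≤ 3.
    have hle : Zubrilina.mightyIndex r ≤ (3 : ℕ) := by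
      refine iSup₂_le fun m hm => Nat.cast_le.2 ?_
      by_contra hlt
      have h5 := (Zubrilina.four_le_of_nthPrime.1 (show 4 ≤ m by omega)).2
      have hp := hm.2.1
      rcases lt_trichotomy (Zubrilina.nthPrime m) 7 with h | h | h
      · have h6 : Zubrilina.nthPrime m = 6 := by omega
        rw [h6] at hp
        exact absurd hp (by norm_num)
      · exact h7 (h ▸ hm.2)
      · exact Zubrilina.not_isMighty_of_gt_seven hr hr3 hp h hm.2
    have : ((4 : ℕ) : ℕ∞) ≤ (3 : ℕ) := hL.trans hle
    exact absurd (Nat.cast_le.1 this) (by norm_num)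
  refine ⟨h1, h2, by norm_num, fun r hr h6 => ?_⟩
  rcases le_or_gt (Zubrilina.mightyIndex r) 3 with hL | hL
  · have := h1 r hr hL
    rw [h6] at this
    exact absurd (Nat.cast_le (α := ℕ∞) (m := 6) (n := 5) |>.1 this) (by norm_num)
  · have := h2 r hr (Order.add_one_le_of_lt hL)
    rw [h6] at this
    exact absurd (Nat.cast_le (α := ℕ∞) (m := 7) (n := 6) |>.1 this) (by norm_num)
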